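/- **Model.** Let $F$ be a probability distribution supported in $[0,1]$, $n\ge 1$, and let $X_1,\dots,X_n$ be i.i.d. with law $F$. The full recall game $\Gamma_n^{FR}$ has two players. At each stage $t=1,\dots,n$ the value $X_t$ of item $t$ is publicly drawn. At a stage $t<n$, each player still in the market then simultaneously chooses (possibly at random) either to bid for one of the items $1,\dots,t$ that nobody has got so far, or to pass. A player who alone bids for an item gets it; if both players bid for the same item, a fair coin decides which of them gets it. A player who gets item $j$ leaves the market with payoff $X_j$, and the item is no longer available; the others continue to the next stage. Bids and allocations are public. At stage $n$ every player still present takes the best available item; if both are present, a fair coin decides who gets it, and the other gets the second best item (worth $0$ if there is none). A (behaviour) strategy assigns, measurably, to each history observed (past samples including the current one, past bids and allocations) a probability distribution over the available actions. Payoffs are expected values. A subgame-perfect equilibrium (SPE) is a pair of strategies inducing a Nash equilibrium in the continuation game after every finite history, and $E_n^{FR}\subset\mathbb{R}^2$ is the set of payoff pairs of the SPE of $\Gamma_n^{FR}$. For $0\le b\le a\le 1$ define recursively $l_0(a,b)=h_0(a,b)=\frac{a+b}{2}$ and, for $m\ge 1$, $$l_m(a,b)=L\bigl(a,\ \mathbb{E}(X_{(m)}\vee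 b),\ \mathbb{E}_X\, l_{m-1}(a\vee X,\mathrm{med}[a,b,X])\bigr),$$ $$h_m(a,b)=H\bigl(a,\ \mathbb{E}(X_{(m)}\vee b),\ \mathbb{E}_X\, h_{m-1}(a\vee X,\mathrm{med}[a,b,X])\bigr),$$ where $X$ has law $F$, $X_{(m)}=\max\{X_1,\dots,X_m\}$ for i.i.d. $X_1,\dots,X_m$ of law $F$, $\mathrm{med}$ is the median, and $$L(x,y,z)=\begin{cases} z & x\le y,\\ \frac{x+y}{2} & x>y,\end{cases}\qquad H(x,y,z)=\begin{cases}\frac{x+y}{2} & x>y\vee z,\\ z & x\le y\vee z.\end{cases}$$ **Theorem.** Assume $F$ is continuous (atomless). Then for every $n\ge 1$, with $l_n=l_n(0,0)$ and $h_n=h_n(0,0)$, $$E_n^{FR}=\{\lambda(l_n,l_n)+(1-\lambda)(h_n,h_n):\ \lambda\in[0,1]\}.$$ That is, $E_n^{FR}$ is convex, contained in the diagonal, and its extreme points are $(l_n,l_n)$ and $(h_n,h_n)$. -/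

import Mathlib

open MeasureTheory

namespace FullRecall

/-- The two players. -/
abbrev Player := Fin 2

/-- What is publicly seen at a stage at which `t` items have arrived so far, besides the new sample:
the bid of each player and the item each player got.  Items are named by their order of arrival;
`none` means no item. -/
structure Outcome (t : ℕ) where
  bid : Player → Option (Fin t)
  got : Player → Option (Fin t)

/-- Records of everything, apart from the values of the samples, that happened during the first `t`
stages.  A full history consists of such a record together with the values of the samples. -/
inductive Hist : ℕ → Type
  | start : Hist 0
  | next {t : ℕ} (h : Hist t) (o : Outcome (t + 1)) : Hist (t + 1)

/-- The players still in the market after the stages recorded in `h`. -/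
def present : {t : ℕ} → Hist t → Finset Player
  | _, .start => Finset.univ
  | _, .next h o => (present h).filter fun i => o.got i = none

/-- The feasible set at stage `t + 1`: the items among the first `t + 1` that nobody got during the
first `t` stages.  (The item arriving at stage `t + 1` is `Fin.last t`.) -/
def feasible : {t : ℕ} → Hist t → Finset (Fin (t + 1))
  | _, .start => Finset.univ
  | _, .next (t := t) h o =>
      insert (Fin.last (t + 1))
        (((feasible h).filter fun j => ∀ i, o.got i ≠ some j).map Fin.castSuccEmb)

/-- The pure actions of player `i` at stage `t + 1`: a player who is in the market may bid for any
feasible item or for nothing; a player who has left can do nothing. -/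
def actions {t : ℕ} (h : Hist t) (i : Player) : Finset (Option (Fin (t + 1))) :=
  if i ∈ present h then Finset.insertNone (feasible h) else {none}

/-- The item each player gets when the bids are `b` and the coin used to break ties designates
player `w`: if both bid for the same item, only `w` gets it; otherwise all bids are served. -/
def allocate {t : ℕ} (b : Player → Option (Fin t)) (w : Player) : Player → Option (Fin t) :=
  fun i => if b 0 = b 1 ∧ i ≠ w then none else b i

/-- The records that are possible under the rules of the game. -/
def Possible : {t : ℕ} → Hist t → Prop
  | _, .start => True
  | _, .next h o =>
      Possible h ∧ ∃ (b : Player → Option (Fin _)) (w : Player),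
        (∀ i, b i ∈ actions h i) ∧ o = ⟨b, allocate b w⟩

/-- A (behaviour) strategy of player `i`: at stage `t + 1`, to the record `h` of the first `t`
stages and the values `x` of the first `t + 1` samples it associates a probability distribution over
the available actions, in a measurable way.  (There are countably many records for each `t`, so
measurability in the whole history is measurability in `x` for each record.) -/
structure Strategy (i : Player) where
  prob : {t : ℕ} → Hist t → (Fin (t + 1) → unitInterval) → Option (Fin (t + 1)) → ℝ
  prob_nonneg : ∀ {t : ℕ} (h : Hist t) x a, 0 ≤ prob h x a
  prob_sum : ∀ {t : ℕ} (h : Hist t) x, ∑ a, prob h x a = 1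
  prob_eq_zero : ∀ {t : ℕ} (h : Hist t) x a, a ∉ actions h i → prob h x a = 0
  measurable_prob : ∀ {t : ℕ} (h : Hist t) a, Measurable fun x => prob h x a

/-- A pair of strategies. -/
abbrev Profile := (i : Player) → Strategy i

/-- The largest value of an item in `A` (`0` if there is none). -/
def best {t : ℕ} (A : Finset (Fin t)) (x : Fin t → unitInterval) : unitInterval :=
  A.sup x

/-- The second largest value, with multiplicity, of an item in `A` (`0` if `A` has fewer than two
items). -/
def secondBest {t : ℕ} (A : Finset (Fin t)) (x : Fin t → unitInterval) : unitInterval :=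
  A.offDiag.sup fun p => x p.1 ⊓ x p.2

/-- The expected gain of player `i` from the last stage on: everybody who is present selects the best
available item; if both are present, a fair coin decides who gets it and the other one gets the
second best item. -/
noncomputable def lastGain {t : ℕ} (h : Hist t) (x : Fin (t + 1) → unitInterval) (i : Player) : ℝ :=
  if i ∉ present h then 0
  else if present h = Finset.univ then
    ((best (feasible h) x : ℝ) + (secondBest (feasible h) x : ℝ)) / 2
  else (best (feasible h) x : ℝ)

/-- The value of the item a player just got (`0` if he got none). -/
def gain {t : ℕ} (x : Fin t → unitInterval) : Option (Fin t) → ℝ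
  | none => 0
  | some j => x j

/-- The expected gain of player `i` from stage `t + 1` on, given the record `h` of the first `t`
stages and the values `x` of the first `t + 1` samples, when `r` stages remain after stage `t + 1`
and `σ` is played. -/
noncomputable def value (F : Measure unitInterval) (σ : Profile) :
    (r : ℕ) → {t : ℕ} → Hist t → (Fin (t + 1) → unitInterval) → Player → ℝ
  | 0, _, h, x, i => lastGain h x i
  | r + 1, t, h, x, i =>
      ∑ b : Player → Option (Fin (t + 1)), (∏ j, (σ j).prob h x (b j)) *
        ∑ w : Player, (1 / 2 : ℝ) *
          (gain x (allocate b w i) +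
            ∫ y, value F σ r (h.next ⟨b, allocate b w⟩) (Fin.snoc x y : Fin (t + 2) → unitInterval) i ∂F)

/-- The same expected gain, before the sample of stage `t + 1` is drawn. -/
noncomputable def valueBefore (F : Measure unitInterval) (σ : Profile) (r : ℕ) {t : ℕ} (h : Hist t)
    (x : Fin t → unitInterval) (i : Player) : ℝ :=
  ∫ y, value F σ r h (Fin.snoc x y : Fin (t + 1) → unitInterval) i ∂F

/-- The payoff of player `i` in the full recall game with `n` samples. -/
noncomputable def payoff (F : Measure unitInterval) (σ : Profile) : (n : ℕ) → Player → ℝ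
  | 0, _ => 0
  | r + 1, i => valueBefore F σ r Hist.start Fin.elim0 i

/-- Subgame-perfect equilibria of the full recall game with `n` samples: after every finite history,
whether or not the next sample has already been drawn, no player can gain by deviating. -/
def IsSPE (F : Measure unitInterval) (n : ℕ) (σ : Profile) : Prop :=
  ∀ (t r : ℕ), t + 1 + r = n → ∀ h : Hist t, Possible h → ∀ (i : Player) (τ : Strategy i),
    (∀ x : Fin t → unitInterval,
      valueBefore F (Function.update σ i τ) r h x i ≤ valueBefore F σ r h x i) ∧
    (∀ x : Fin (t + 1) → unitInterval,
      value F (Function.update σ i τ) r h x i ≤ value F σ r h x i)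

/-- The set of subgame-perfect equilibrium payoffs of the full recall game with `n` samples. -/
def spePayoffs (F : Measure unitInterval) (n : ℕ) : Set (ℝ × ℝ) :=
  {p | ∃ σ : Profile, IsSPE F n σ ∧ p = (payoff F σ n 0, payoff F σ n 1)}

/-- The median of three values. -/
def med (a b c : unitInterval) : unitInterval := (a ⊓ b) ⊔ ((a ⊔ b) ⊓ c)

/-- `E[max (X₁, …, Xₙ, b)]` for independent `X₁, …, Xₙ` of law `F`. -/
noncomputable def expMax (F : Measure unitInterval) (n : ℕ) (b : unitInterval) : ℝ :=
  ∫ X : Fin n → unitInterval, ((Finset.univ.sup X ⊔ b : unitInterval) : ℝ) ∂Measure.pi fun _ => F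

noncomputable def L (x y z : ℝ) : ℝ := if x ≤ y then z else (x + y) / 2

noncomputable def H (x y z : ℝ) : ℝ := if x > max y z then (x + y) / 2 else z

/-- `lₙ(a, b)`. -/
noncomputable def low (F : Measure unitInterval) : ℕ → unitInterval → unitInterval → ℝ
  | 0, a, b => ((a : ℝ) + b) / 2
  | n + 1, a, b => L a (expMax F (n + 1) b) (∫ X, low F n (a ⊔ X) (med a b X) ∂F)

/-- `hₙ(a, b)`. -/
noncomputable def high (F : Measure unitInterval) : ℕ → unitInterval → unitInterval → ℝ
  | 0, a, b => ((a : ℝ) + b) / 2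
  | n + 1, a, b => H a (expMax F (n + 1) b) (∫ X, high F n (a ⊔ X) (med a b X) ∂F)

end FullRecall

namespace FullRecall

/-! As long as both players are present nobody has bid, so the record is that of constant passing
and the state reduces to the pair (a, b) of the two largest samples. A player left alone loses
nothing by waiting until the end, which is worth `expMax`. Each stage with both present is therefore
a symmetric one-shot game: mutual passing gives each a continuation payoff z, a lone bid for the
best item gives x = a to the bidder and y = E(X_(m) ∨ b) to the other, and a common bid for it gives
(x + y)/2 to each.

Postponing the first departure by one stage never lowers the total payoff, because `expMax` is
1-Lipschitz; hence z ≥ (x + y)/2. If x < y, passing strictly dominates and the payoff is z. If x >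
y, only passing and bidding for the best item are ever played; both bidding is an equilibrium, and
both passing is one exactly when z ≥ x. Since the incentive to pass grows with the opponent's
probability of passing, every equilibrium of this two-by-two game gives equal payoffs, at least (x +
y)/2, and equal to (x + y)/2 unless x ≤ z, when they are at most z (`two_action_equilibrium`).
Backward induction then yields the bounds `low` and `high` (`IsSPE.value_passHist`).

When x = y, bidding may survive in equilibrium with a payoff below z, so the bounds can fail. For
atomless F such states are almost surely never reached (`ae_regular_start`, `ae_regular_next`).

Both bounds are attained by pure equilibria, and so is everything in between: the equilibrium for
`high` is played if the first sample is at most a cutoff c, the one for `low` otherwise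
(`isSPE_cutoffProfile`). The payoff is continuous in c because F has no atoms, and the intermediate
value theorem fills the segment. -/

lemma integrable_of_abs_le {α : Type*} [MeasurableSpace α] {μ : Measure α} [IsFiniteMeasure μ]
    {f : α → ℝ} (hf : Measurable f) {C : ℝ} (hC : ∀ x, |f x| ≤ C) : Integrable f μ :=
  Integrable.of_bound hf.aestronglyMeasurable C (Filter.Eventually.of_forall hC)

lemma abs_coe_le_one (x : unitInterval) : |(x : ℝ)| ≤ 1 := by
  rw [abs_of_nonneg x.2.1]; exact x.2.2

/-! ### The value of waiting alone. -/

section ExpMax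

variable (F : Measure unitInterval) [IsProbabilityMeasure F]

@[simp] lemma expMax_zero (b : unitInterval) : expMax F 0 b = b := by
  simp [expMax]

/-- Splitting off one sample and letting it raise the floor `b` gives the recursion obeyed by the
payoff of a player who waits alone. -/
lemma expMax_succ (m : ℕ) (b : unitInterval) :
    expMax F (m + 1) b = ∫ X, expMax F m (b ⊔ X) ∂F := by
  have hmp := (measurePreserving_piFinSuccAbove (fun _ : Fin (m + 1) => F) 0).symm
  have hc : Continuous fun p : unitInterval × (Fin m → unitInterval) =>
      ((Finset.univ.sup p.2 ⊔ (b ⊔ p.1) : unitInterval) : ℝ) := by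
    refine continuous_subtype_val.comp (Continuous.sup ?_ (by fun_prop))
    exact Continuous.finset_sup_apply fun i _ => by fun_prop
  have hcomp := hmp.integral_comp' (g := fun X : Fin (m + 1) → unitInterval =>
    ((Finset.univ.sup X ⊔ b : unitInterval) : ℝ))
  have hpt : ∀ p : unitInterval × (Fin m → unitInterval),
      (Finset.univ.sup ((MeasurableEquiv.piFinSuccAbove (fun _ : Fin (m + 1) => unitInterval) 0).symm
        p) ⊔ b : unitInterval) = Finset.univ.sup p.2 ⊔ (b ⊔ p.1) := by
    rintro ⟨y, X⟩
    rw [Fin.univ_succ, Finset.sup_cons, Finset.sup_map]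
    change (y ⊔ Finset.univ.sup X) ⊔ b = _
    ac_rfl
  unfold expMax
  rw [← hcomp]
  simp_rw [hpt]
  rw [integral_prod _ (integrable_of_abs_le hc.measurable fun p => abs_coe_le_one _)]

/-- The four properties share one induction because monotonicity and the bounds supply the
integrability that each step needs. The Lipschitz bound is what makes delay harmless. -/
lemma expMax_props (m : ℕ) :
    (∀ b : unitInterval, (b : ℝ) ≤ expMax F m b) ∧ (∀ b, expMax F m b ≤ 1) ∧ Monotone (expMax F m) ∧
      ∀ b b' : unitInterval, b ≤ b' → expMax F m b' - expMax F m b ≤ (b' : ℝ) - b := by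
  induction m with
  | zero =>
    refine ⟨fun b => by simp, fun b => by simpa using b.2.2, fun b b' h => by simpa using h,
      fun b b' _ => by simp⟩
  | succ m ih =>
    obtain ⟨h1, h2, h3, h4⟩ := ih
    have hint : ∀ b, Integrable (fun X => expMax F m (b ⊔ X)) F := fun b =>
      integrable_of_abs_le (C := 1) (Monotone.measurable fun X Y h => h3 (sup_le_sup_left h b))
        fun X => abs_le.2 ⟨by linarith [h1 (b ⊔ X), (b ⊔ X).2.1], h2 _⟩
    refine ⟨fun b => ?_, fun b => ?_, fun b b' h => ?_, fun b b' h => ?_⟩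
    · rw [expMax_succ]
      calc (b : ℝ) = ∫ _, (b : ℝ) ∂F := by simp
        _ ≤ _ := integral_mono (integrable_const _) (hint b) fun X =>
            (show (b : ℝ) ≤ ((b ⊔ X : unitInterval) : ℝ) from le_sup_left (a := b)).trans (h1 _)
    · rw [expMax_succ]
      calc _ ≤ ∫ _, (1 : ℝ) ∂F := integral_mono (hint b) (integrable_const _) fun X => h2 _
        _ = 1 := by simp
    · rw [expMax_succ, expMax_succ]
      exact integral_mono (hint b) (hint b') fun X => h3 (sup_le_sup_right h X)
    · rw [expMax_succ, expMax_succ, ← integral_sub (hint b') (hint b)]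
      calc _ ≤ ∫ _, ((b' : ℝ) - b) ∂F :=
            integral_mono ((hint b').sub (hint b)) (integrable_const _) fun X => by
              refine (h4 _ _ (sup_le_sup_right h X)).trans ?_
              have h' : (b : ℝ) ≤ b' := h
              change max (b' : ℝ) X - max (b : ℝ) X ≤ _
              rcases max_cases (b' : ℝ) X with h5 | h5 <;> rcases max_cases (b : ℝ) X with h6 | h6 <;>
                linarith
        _ = _ := by simp

lemma le_expMax (m : ℕ) (b : unitInterval) : (b : ℝ) ≤ expMax F m b := (expMax_props F m).1 b

lemma expMax_le_one (m : ℕ) (b : unitInterval) : expMax F m b ≤ 1 := (expMax_props F m).2.1 b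

lemma expMax_mono (m : ℕ) : Monotone (expMax F m) := (expMax_props F m).2.2.1

lemma expMax_sub_le (m : ℕ) {b b' : unitInterval} (h : b ≤ b') :
    expMax F m b' - expMax F m b ≤ (b' : ℝ) - b := (expMax_props F m).2.2.2 b b' h

lemma expMax_nonneg (m : ℕ) (b : unitInterval) : 0 ≤ expMax F m b := b.2.1.trans (le_expMax F m b)

lemma measurable_expMax (m : ℕ) : Measurable (expMax F m) := (expMax_mono F m).measurable

lemma abs_expMax_le (m : ℕ) (b : unitInterval) : |expMax F m b| ≤ 1 :=
  abs_le.2 ⟨by linarith [expMax_nonneg F m b], expMax_le_one F m b⟩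

lemma integrable_expMax_comp {f : unitInterval → unitInterval} (hf : Measurable f) (m : ℕ) :
    Integrable (fun X => expMax F m (f X)) F :=
  integrable_of_abs_le ((measurable_expMax F m).comp hf) fun _ => abs_expMax_le F m _

/-- On the event that all `m` samples are at most `b`, raising the floor to `b'` raises the maximum
by the full `b' - b`. This gives strict monotonicity wherever `F (Set.Iic b)` is positive. -/
lemma le_expMax_sub (m : ℕ) {b b' : unitInterval} (h : b ≤ b') :
    F.real (Set.Iic b) ^ m * ((b' : ℝ) - b) ≤ expMax F m b' - expMax F m b := by
  induction m with
  | zero => simp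
  | succ m ih =>
    have hint := fun c : unitInterval => integrable_expMax_comp F (f := fun X => c ⊔ X)
      (measurable_const.sup measurable_id) m
    rw [expMax_succ, expMax_succ, ← integral_sub (hint b') (hint b)]
    calc _ = F.real (Set.Iic b) * (F.real (Set.Iic b) ^ m * ((b' : ℝ) - b)) := by ring
      _ = ∫ X, (Set.Iic b).indicator (fun _ => F.real (Set.Iic b) ^ m * ((b' : ℝ) - b)) X ∂F := by
          rw [integral_indicator_const _ measurableSet_Iic, smul_eq_mul]
      _ ≤ _ := by
          refine integral_mono ((integrable_const _).indicator measurableSet_Iic)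
            ((hint b').sub (hint b)) fun X => ?_
          by_cases hX : X ≤ b
          · simpa [Set.indicator, hX, sup_eq_left.2 hX, sup_eq_left.2 (hX.trans h)] using ih
          · simpa [Set.indicator, hX] using expMax_mono F m (sup_le_sup_right h X)

end ExpMax

/-! ### The recursive payoff bounds. -/

section Bounds

variable (F : Measure unitInterval) [IsProbabilityMeasure F]

lemma med_le_sup (a b X : unitInterval) : med a b X ≤ a ⊔ X := by
  unfold med
  exact sup_le (inf_le_left.trans le_sup_left) (inf_le_right.trans le_sup_right)

lemma med_of_le {a b X : unitInterval} (h : b ≤ a) (hX : X ≤ a) : med a b X = b ⊔ X := by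
  simp [med, inf_eq_right.2 h, sup_eq_left.2 h, inf_eq_right.2 hX]

lemma med_of_ge {a b X : unitInterval} (h : b ≤ a) (hX : a ≤ X) : med a b X = a := by
  simp [med, inf_eq_left.2 hX, h]

lemma measurable_next {g : unitInterval × unitInterval → ℝ} (hg : Measurable g) :
    Measurable fun q : (unitInterval × unitInterval) × unitInterval =>
      g (q.1.1 ⊔ q.2, med q.1.1 q.1.2 q.2) := by
  refine hg.comp (Continuous.measurable ?_)
  unfold med; fun_prop

lemma measurable_integral_next {g : unitInterval × unitInterval → ℝ} (hg : Measurable g) :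
    Measurable fun p : unitInterval × unitInterval => ∫ X, g (p.1 ⊔ X, med p.1 p.2 X) ∂F :=
  ((measurable_next hg).stronglyMeasurable.integral_prod_right').measurable

lemma measurable_expMax_snd (m : ℕ) :
    Measurable fun p : unitInterval × unitInterval => expMax F m p.2 :=
  (measurable_expMax F m).comp measurable_snd

lemma measurable_low (m : ℕ) : Measurable fun p : unitInterval × unitInterval => low F m p.1 p.2 := by
  induction m with
  | zero => unfold low; fun_prop
  | succ m ih =>
    have h1 := measurable_expMax_snd F (m + 1)
    have h2 := measurable_integral_next F ih
    have h3 : Measurable fun p : unitInterval × unitInterval => (p.1 : ℝ) := by fun_prop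
    unfold low L
    exact Measurable.ite (measurableSet_le h3 h1) h2 ((h3.add h1).div_const 2)

lemma measurable_high (m : ℕ) :
    Measurable fun p : unitInterval × unitInterval => high F m p.1 p.2 := by
  induction m with
  | zero => unfold high; fun_prop
  | succ m ih =>
    have h1 := measurable_expMax_snd F (m + 1)
    have h2 := measurable_integral_next F ih
    have h3 : Measurable fun p : unitInterval × unitInterval => (p.1 : ℝ) := by fun_prop
    unfold high H
    exact Measurable.ite (measurableSet_lt (h1.max h2) h3) ((h3.add h1).div_const 2) h2

/-- The expected value of the lower bound at the next stage, when both players pass. -/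
noncomputable def nextLow (m : ℕ) (a b : unitInterval) : ℝ :=
  ∫ X, low F m (a ⊔ X) (med a b X) ∂F

/-- The expected value of the upper bound at the next stage, when both players pass. -/
noncomputable def nextHigh (m : ℕ) (a b : unitInterval) : ℝ :=
  ∫ X, high F m (a ⊔ X) (med a b X) ∂F

lemma low_succ (F : Measure unitInterval) (m : ℕ) (a b : unitInterval) :
    low F (m + 1) a b = L a (expMax F (m + 1) b) (nextLow F m a b) := rfl

lemma high_succ (F : Measure unitInterval) (m : ℕ) (a b : unitInterval) :
    high F (m + 1) a b = H a (expMax F (m + 1) b) (nextHigh F m a b) := rfl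

lemma measurable_nextHigh (m : ℕ) :
    Measurable fun p : unitInterval × unitInterval => nextHigh F m p.1 p.2 :=
  measurable_integral_next F (measurable_high F m)

lemma abs_integral_le_one {f : unitInterval → ℝ} (h : ∀ x, |f x| ≤ 1) : |∫ x, f x ∂F| ≤ 1 := by
  have := norm_integral_le_of_norm_le_const (μ := F) (f := f) (C := 1)
    (Filter.Eventually.of_forall h)
  simpa using this

lemma abs_half_add_le {x y : ℝ} (hx : |x| ≤ 1) (hy : |y| ≤ 1) : |(x + y) / 2| ≤ 1 := by
  rw [abs_le] at *; constructor <;> linarith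

lemma abs_low_le (m : ℕ) (a b : unitInterval) : |low F m a b| ≤ 1 := by
  induction m generalizing a b with
  | zero => exact abs_half_add_le (abs_coe_le_one a) (abs_coe_le_one b)
  | succ m ih =>
    rw [low_succ, L]
    split_ifs
    · exact abs_integral_le_one F fun X => ih _ _
    · exact abs_half_add_le (abs_coe_le_one a) (abs_expMax_le F _ b)

lemma abs_high_le (m : ℕ) (a b : unitInterval) : |high F m a b| ≤ 1 := by
  induction m generalizing a b with
  | zero => exact abs_half_add_le (abs_coe_le_one a) (abs_coe_le_one b)
  | succ m ih =>
    rw [high_succ, H]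
    split_ifs
    · exact abs_half_add_le (abs_coe_le_one a) (abs_expMax_le F _ b)
    · exact abs_integral_le_one F fun X => ih _ _

lemma measurable_next_section {g : unitInterval × unitInterval → ℝ} (hg : Measurable g)
    (a b : unitInterval) : Measurable fun X => g (a ⊔ X, med a b X) :=
  (measurable_next hg).comp (measurable_prodMk_left (x := (a, b)))

lemma integrable_low_next (m : ℕ) (a b : unitInterval) :
    Integrable (fun X => low F m (a ⊔ X) (med a b X)) F :=
  integrable_of_abs_le (measurable_next_section (measurable_low F m) a b)
    fun _ => abs_low_le F m _ _

lemma integrable_high_next (m : ℕ) (a b : unitInterval) :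
    Integrable (fun X => high F m (a ⊔ X) (med a b X)) F :=
  integrable_of_abs_le (measurable_next_section (measurable_high F m) a b)
    fun _ => abs_high_le F m _ _

/-- Stopping one stage later does not decrease the total payoff. -/
lemma add_expMax_le_next (m : ℕ) {a b : unitInterval} (h : b ≤ a) (X : unitInterval) :
    (a : ℝ) + expMax F m (b ⊔ X) ≤ (a ⊔ X : unitInterval) + expMax F m (med a b X) := by
  rcases le_total X a with hX | hX
  · rw [med_of_le h hX, sup_eq_left.2 hX]
  · rw [med_of_ge h hX, sup_eq_right.2 hX, sup_eq_right.2 (h.trans hX)]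
    linarith [expMax_sub_le F m hX]

/-- Averages `add_expMax_le_next` over the new sample. The bound for `low` is a hypothesis so that
the argument can be used inside the induction of `half_le_low` and again after it. -/
lemma half_le_nextLow_of (m : ℕ)
    (hlow : ∀ {a b : unitInterval}, b ≤ a → ((a : ℝ) + expMax F m b) / 2 ≤ low F m a b)
    {a b : unitInterval} (h : b ≤ a) :
    ((a : ℝ) + expMax F (m + 1) b) / 2 ≤ nextLow F m a b := by
  have hint := integrable_expMax_comp F (f := fun X => b ⊔ X)
    (measurable_const.sup measurable_id) m
  calc ((a : ℝ) + expMax F (m + 1) b) / 2 = ∫ X, ((a : ℝ) + expMax F m (b ⊔ X)) / 2 ∂F := by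
        rw [integral_div, integral_add (integrable_const _) hint, ← expMax_succ]; simp
    _ ≤ nextLow F m a b := by
        refine integral_mono (((integrable_const _).add hint).div_const 2)
          (integrable_low_next F m a b) fun X => ?_
        have h1 := hlow (med_le_sup a b X)
        have h2 := add_expMax_le_next F m h X
        linarith

lemma half_le_low (m : ℕ) {a b : unitInterval} (h : b ≤ a) :
    ((a : ℝ) + expMax F m b) / 2 ≤ low F m a b := by
  induction m generalizing a b with
  | zero => simp [low]
  | succ m ih =>
    rw [low_succ, L]
    split_ifs
    · exact half_le_nextLow_of F m ih h
    · rfl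

lemma half_le_nextLow (m : ℕ) {a b : unitInterval} (h : b ≤ a) :
    ((a : ℝ) + expMax F (m + 1) b) / 2 ≤ nextLow F m a b :=
  half_le_nextLow_of F m (half_le_low F m) h

lemma nextLow_le_nextHigh_of (m : ℕ)
    (hle : ∀ {a b : unitInterval}, b ≤ a → low F m a b ≤ high F m a b)
    (a b : unitInterval) : nextLow F m a b ≤ nextHigh F m a b :=
  integral_mono (integrable_low_next F m a b) (integrable_high_next F m a b)
    fun X => hle (med_le_sup a b X)

/-- The only branches that differ in substance are those where `L` stops and `H` continues; there
the stopping payoff is at most `nextLow`, hence at most `nextHigh`. The opposite mismatch would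
require both x ≤ y and y < x. -/
lemma low_le_high (m : ℕ) {a b : unitInterval} (h : b ≤ a) : low F m a b ≤ high F m a b := by
  induction m generalizing a b with
  | zero => exact le_rfl
  | succ m ih =>
    have h1 := half_le_nextLow F m h
    have h2 := nextLow_le_nextHigh_of F m ih a b
    rw [low_succ, high_succ, L, H]
    split_ifs with h3 h4
    · exact absurd (le_max_left _ _) (not_le.2 (lt_of_lt_of_le h4 h3))
    · exact h2
    · exact le_rfl
    · exact h1.trans h2

lemma nextLow_le_nextHigh (m : ℕ) (a b : unitInterval) :
    nextLow F m a b ≤ nextHigh F m a b :=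
  nextLow_le_nextHigh_of F m (low_le_high F m) a b

end Bounds

/-! ### Indifference has probability zero. -/

section Regular

/-- At no horizon up to `r` is a player indifferent between the best item and waiting alone with the
second best one. -/
def Regular (F : Measure unitInterval) (r : ℕ) (a b : unitInterval) : Prop :=
  ∀ k, 1 ≤ k → k ≤ r → (a : ℝ) ≠ expMax F k b

variable {F : Measure unitInterval}

lemma measure_subsingleton (hF : ∀ x, F {x} = 0) {S : Set unitInterval}
    (hS : S.Subsingleton) : F S = 0 := by
  rcases hS.eq_empty_or_singleton with rfl | ⟨x, rfl⟩
  · simp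
  · exact hF x

/-- The set is a down-set, and it suffices to show it locally null: a point with a larger member has
a null neighbourhood `Set.Iic y`, and a largest member `x` puts the whole set inside the null set
`Set.Iic x`. -/
lemma measure_setOf_measure_Iic_eq_zero : F {X | F (Set.Iic X) = 0} = 0 := by
  refine measure_null_of_locally_null _ fun x hx => ?_
  by_cases hmax : ∃ y, F (Set.Iic y) = 0 ∧ x < y
  · obtain ⟨y, hy, hxy⟩ := hmax
    exact ⟨Set.Iic y, mem_nhdsWithin_of_mem_nhds (Iic_mem_nhds hxy), hy⟩
  · push Not at hmax
    exact ⟨Set.Iic x, Filter.mem_of_superset self_mem_nhdsWithin fun y hy => hmax y hy, hx⟩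

lemma measure_setOf_coe_eq (hF : ∀ x, F {x} = 0) (c : ℝ) :
    F {X : unitInterval | (X : ℝ) = c} = 0 :=
  measure_subsingleton hF fun _ hX _ hY => Subtype.ext (hX.trans hY.symm)

lemma ae_regular_start (hF : ∀ x, F {x} = 0) (r : ℕ) : ∀ᵐ X ∂F, Regular F r X 0 := by
  have key : ∀ k, ∀ᵐ X : unitInterval ∂F, (1 ≤ k → k ≤ r → (X : ℝ) ≠ expMax F k 0) := by
    intro k
    have h1 : ∀ᵐ X : unitInterval ∂F, ¬ ((X : ℝ) = expMax F k 0) := by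
      simpa [ae_iff] using measure_setOf_coe_eq hF (expMax F k 0)
    filter_upwards [h1] with X hX _ _ using hX
  filter_upwards [ae_all_iff.2 key] with X hX using hX

variable [IsProbabilityMeasure F]

/-- Off the null set where `F (Set.Iic X) = 0`, `expMax` is strictly increasing, so a level set
contains at most one further point. -/
lemma measure_setOf_expMax_eq (hF : ∀ x, F {x} = 0) (m : ℕ) (c : ℝ) :
    F {X | expMax F m X = c} = 0 := by
  set N := {X | F (Set.Iic X) = 0}
  have hsub : ({X | expMax F m X = c} \ N).Subsingleton := by
    have key : ∀ X ∈ {X | expMax F m X = c} \ N, ∀ Y ∈ {X | expMax F m X = c} \ N, ¬ X < Y := by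
      intro X hX Y hY hlt
      have h1 := le_expMax_sub F m hlt.le
      rw [show expMax F m X = c from hX.1, show expMax F m Y = c from hY.1, sub_self] at h1
      have h2 : 0 < F.real (Set.Iic X) := ENNReal.toReal_pos hX.2 (measure_ne_top _ _)
      have h3 : (0 : ℝ) < (Y : ℝ) - X := sub_pos.2 hlt
      exact absurd h1 (not_le.2 (by positivity))
    exact fun X hX Y hY => le_antisymm (not_lt.1 (key Y hY X hX)) (not_lt.1 (key X hX Y hY))
  refine measure_mono_null (t := ({X | expMax F m X = c} \ N) ∪ N) (fun X hX => ?_)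
    (measure_union_null (measure_subsingleton hF hsub) measure_setOf_measure_Iic_eq_zero)
  by_cases h : X ∈ N
  · exact Or.inr h
  · exact Or.inl ⟨hX, h⟩

/-- A new sample below `b` leaves the state unchanged with a shorter horizon, which is why `Regular`
quantifies over all horizons. A sample between `b` and `a` replaces `b`, and must avoid a level set
of `expMax`; a sample above `a` must avoid a single value. -/
lemma ae_regular_next (hF : ∀ x, F {x} = 0) {r : ℕ} {a b : unitInterval} (h : b ≤ a)
    (hreg : Regular F (r + 1) a b) :
    ∀ᵐ X ∂F, Regular F r (a ⊔ X) (med a b X) := by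
  have key : ∀ k, ∀ᵐ X ∂F, (1 ≤ k → k ≤ r → ((a ⊔ X : unitInterval) : ℝ) ≠ expMax F k (med a b X)) := by
    intro k
    have h1 : ∀ᵐ X : unitInterval ∂F, ¬ ((X : ℝ) = expMax F k a) := by
      simpa [ae_iff] using measure_setOf_coe_eq hF (expMax F k a)
    have h2 : ∀ᵐ X ∂F, ¬ (expMax F k X = (a : ℝ)) := by
      simpa [ae_iff] using measure_setOf_expMax_eq hF k (a : ℝ)
    filter_upwards [h1, h2] with X hX1 hX2 hk hkr
    rcases le_total X a with hX | hX
    · rw [med_of_le h hX, sup_eq_left.2 hX]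
      rcases le_total X b with hb | hb
      · rw [sup_eq_left.2 hb]; exact hreg k hk (by omega)
      · rw [sup_eq_right.2 hb]; exact fun h' => hX2 h'.symm
    · rwa [med_of_ge h hX, sup_eq_right.2 hX]
  filter_upwards [ae_all_iff.2 key] with X hX using hX

end Regular

/-! ### The best and second best items. -/

section Items

variable {t : ℕ}

lemma best_univ_snoc (x : Fin (t + 1) → unitInterval) (y : unitInterval) :
    best Finset.univ (Fin.snoc x y : Fin (t + 2) → unitInterval) = best Finset.univ x ⊔ y := by
  unfold best
  rw [Fin.univ_castSuccEmb, Finset.sup_cons, Finset.sup_map, sup_comm]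
  congr 1
  · exact Finset.sup_congr rfl fun i _ => by simp
  · simp

lemma best_insert_last (A : Finset (Fin (t + 1))) (x : Fin (t + 1) → unitInterval)
    (y : unitInterval) :
    best (insert (Fin.last (t + 1)) (A.map Fin.castSuccEmb))
      (Fin.snoc x y : Fin (t + 2) → unitInterval) = best A x ⊔ y := by
  unfold best
  rw [Finset.sup_insert, Finset.sup_map, sup_comm]
  congr 1
  · exact Finset.sup_congr rfl fun i _ => by simp
  · simp

lemma le_best {A : Finset (Fin t)} (x : Fin t → unitInterval) {j : Fin t} (hj : j ∈ A) :
    x j ≤ best A x := Finset.le_sup hj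

lemma best_mono {A B : Finset (Fin t)} (h : A ⊆ B) (x : Fin t → unitInterval) :
    best A x ≤ best B x := Finset.sup_mono h

lemma secondBest_le_best (A : Finset (Fin t)) (x : Fin t → unitInterval) :
    secondBest A x ≤ best A x :=
  Finset.sup_le fun _ hp => inf_le_left.trans (le_best x (Finset.mem_offDiag.1 hp).1)

lemma secondBest_le_best_erase (x : Fin t → unitInterval) (k : Fin t) :
    secondBest Finset.univ x ≤ best (Finset.univ.erase k) x := by
  refine Finset.sup_le fun p hp => ?_
  by_cases h : p.1 = k
  · refine inf_le_right.trans (le_best x (Finset.mem_erase.2 ⟨?_, Finset.mem_univ _⟩))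
    rw [← h]; exact (Finset.mem_offDiag.1 hp).2.2.symm
  · exact inf_le_left.trans (le_best x (Finset.mem_erase.2 ⟨h, Finset.mem_univ _⟩))

lemma le_secondBest (x : Fin t → unitInterval) {j k : Fin t} (h : j ≠ k) (hjk : x k ≤ x j) :
    x k ≤ secondBest Finset.univ x := by
  have := Finset.le_sup (f := fun p : Fin t × Fin t => x p.1 ⊓ x p.2)
    (b := (j, k)) (Finset.mem_offDiag.2 ⟨Finset.mem_univ j, Finset.mem_univ k, h⟩)
  simpa [secondBest, inf_eq_right.2 hjk] using this

lemma best_erase_eq_secondBest (x : Fin t → unitInterval) {j : Fin t} (hj : ∀ k, x k ≤ x j) :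
    best (Finset.univ.erase j) x = secondBest Finset.univ x :=
  le_antisymm (Finset.sup_le fun k hk => le_secondBest x (Finset.ne_of_mem_erase hk).symm (hj k))
    (secondBest_le_best_erase x j)

/-- The first item of maximal value. -/
noncomputable def bestItem (x : Fin (t + 1) → unitInterval) : Fin (t + 1) :=
  (Finset.univ.filter fun j => ∀ k, x k ≤ x j).min' (by
    obtain ⟨j, hj⟩ := Finite.exists_max x
    exact ⟨j, Finset.mem_filter.2 ⟨Finset.mem_univ _, hj⟩⟩)

lemma le_bestItem (x : Fin (t + 1) → unitInterval) (k : Fin (t + 1)) : x k ≤ x (bestItem x) :=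
  (Finset.mem_filter.1 (Finset.min'_mem (Finset.univ.filter fun j => ∀ k, x k ≤ x j) _)).2 k

lemma apply_bestItem (x : Fin (t + 1) → unitInterval) : x (bestItem x) = best Finset.univ x :=
  le_antisymm (le_best x (Finset.mem_univ _)) (Finset.sup_le fun k _ => le_bestItem x k)

lemma bestItem_eq_iff (x : Fin (t + 1) → unitInterval) (j : Fin (t + 1)) :
    bestItem x = j ↔ (∀ k, x k ≤ x j) ∧ ∀ l, l < j → ¬ ∀ k, x k ≤ x l := by
  constructor
  · rintro rfl
    refine ⟨le_bestItem x, fun l hl h => ?_⟩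
    exact absurd (Finset.min'_le (Finset.univ.filter fun j => ∀ k, x k ≤ x j) l
      (Finset.mem_filter.2 ⟨Finset.mem_univ _, h⟩)) (not_le.2 hl)
  · rintro ⟨h1, h2⟩
    refine le_antisymm (Finset.min'_le _ _ (Finset.mem_filter.2 ⟨Finset.mem_univ _, h1⟩)) ?_
    exact not_lt.1 fun h => h2 _ h (le_bestItem x)

lemma measurableSet_bestItem_eq (j : Fin (t + 1)) :
    MeasurableSet {x : Fin (t + 1) → unitInterval | bestItem x = j} := by
  have h : ∀ l : Fin (t + 1), MeasurableSet {x : Fin (t + 1) → unitInterval | ∀ k, x k ≤ x l} := by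
    intro l
    rw [Set.ofPred_forall]
    exact MeasurableSet.iInter fun k => measurableSet_le (measurable_pi_apply k) (measurable_pi_apply l)
  have heq : {x : Fin (t + 1) → unitInterval | bestItem x = j} = {x | ∀ k, x k ≤ x j} ∩
      ⋂ l, ⋂ (_ : l < j), {x : Fin (t + 1) → unitInterval | ∀ k, x k ≤ x l}ᶜ := by
    ext x
    simp [bestItem_eq_iff]
  rw [heq]
  exact (h j).inter (MeasurableSet.iInter fun l => MeasurableSet.iInter fun _ => (h l).compl)

lemma best_erase_of_ne_bestItem (x : Fin (t + 1) → unitInterval) {k : Fin (t + 1)}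
    (hk : k ≠ bestItem x) : best (Finset.univ.erase k) x = best Finset.univ x :=
  le_antisymm (best_mono (Finset.erase_subset _ _) x) (by
    rw [← apply_bestItem]
    exact le_best x (Finset.mem_erase.2 ⟨hk.symm, Finset.mem_univ _⟩))

lemma le_secondBest_of_ne_bestItem (x : Fin (t + 1) → unitInterval) {k : Fin (t + 1)}
    (hk : k ≠ bestItem x) : x k ≤ secondBest Finset.univ x :=
  le_secondBest x hk.symm (le_bestItem x k)

lemma continuous_best (A : Finset (Fin t)) : Continuous (best A) :=
  Continuous.finset_sup_apply fun i _ => continuous_apply i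

lemma continuous_secondBest (A : Finset (Fin t)) : Continuous (secondBest A) :=
  Continuous.finset_sup_apply fun p _ => (continuous_apply p.1).inf (continuous_apply p.2)

/-- Once a maximal item of the enlarged sample is known, the second best value is the best value
without that item. The maximal item is the old one or the new one according to the position of `y`.
-/
lemma secondBest_univ_snoc (x : Fin (t + 1) → unitInterval) (y : unitInterval) :
    secondBest Finset.univ (Fin.snoc x y : Fin (t + 2) → unitInterval) =
      med (best Finset.univ x) (secondBest Finset.univ x) y := by
  set s : Fin (t + 2) → unitInterval := Fin.snoc x y
  have hs : ∀ k : Fin (t + 1), s k.castSucc = x k := fun k => by simp [s]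
  have hl : s (Fin.last (t + 1)) = y := by simp [s]
  have hab := secondBest_le_best Finset.univ x
  rcases le_total y (best Finset.univ x) with hy | hy
  · rw [med_of_le hab hy]
    have hmax : ∀ k, s k ≤ s (bestItem x).castSucc := by
      intro k
      rw [hs, apply_bestItem x]
      refine Fin.lastCases ?_ (fun k => ?_) k
      · rwa [hl]
      · rw [hs]; exact le_best x (Finset.mem_univ _)
    rw [← best_erase_eq_secondBest s hmax, ← best_erase_eq_secondBest x (le_bestItem x),
      ← best_insert_last]
    congr 1
    ext k
    refine Fin.lastCases ?_ (fun k => ?_) k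
    · simp [Fin.ext_iff]; omega
    · simp [Fin.ext_iff]; omega
  · rw [med_of_ge hab hy]
    have hmax : ∀ k, s k ≤ s (Fin.last (t + 1)) := by
      intro k
      rw [hl]
      refine Fin.lastCases ?_ (fun k => ?_) k
      · rw [hl]
      · rw [hs]; exact (le_best x (Finset.mem_univ _)).trans hy
    rw [← best_erase_eq_secondBest s hmax]
    have : (Finset.univ.erase (Fin.last (t + 1))) = Finset.univ.map Fin.castSuccEmb := by
      ext k
      refine Fin.lastCases ?_ (fun k => ?_) k
      · simp [Fin.ext_iff]; intro a; omega
      · simp [Fin.ext_iff]; omega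
    rw [this, best, Finset.sup_map]
    exact Finset.sup_congr rfl fun k _ => hs k

end Items

/-- The opponent. -/
def opp (i : Player) : Player := 1 - i

lemma opp_ne (i : Player) : opp i ≠ i := by revert i; decide

lemma eq_opp_of_ne {i j : Player} (h : j ≠ i) : j = opp i := by revert i j; decide

/-! ### Records with both players present. -/

section Records

/-- The record in which everybody always passed. -/
def passHist : (t : ℕ) → Hist t
  | 0 => .start
  | t + 1 => (passHist t).next ⟨fun _ => none, fun _ => none⟩

@[simp] lemma present_passHist (t : ℕ) : present (passHist t) = Finset.univ := by
  induction t with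
  | zero => rfl
  | succ t ih => simp [passHist, present, ih]

@[simp] lemma feasible_passHist (t : ℕ) : feasible (passHist t) = Finset.univ := by
  induction t with
  | zero => rfl
  | succ t ih =>
    ext k
    refine Fin.lastCases ?_ (fun k => ?_) k <;> simp [passHist, feasible, ih]

@[simp] lemma actions_passHist (t : ℕ) (i : Player) : actions (passHist t) i = Finset.univ := by
  ext a
  cases a <;> simp [actions]

lemma none_mem_actions {t : ℕ} (h : Hist t) (i : Player) : none ∈ actions h i := by
  unfold actions; split_ifs <;> simp

lemma eq_none_of_notMem_present {t : ℕ} {h : Hist t} {i : Player} (hi : i ∉ present h)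
    {a : Option (Fin (t + 1))} (ha : a ∈ actions h i) : a = none := by
  simpa [actions, hi] using ha

lemma possible_passHist (t : ℕ) : Possible (passHist t) := by
  induction t with
  | zero => trivial
  | succ t ih =>
    refine ⟨ih, fun _ => none, 0, fun i => none_mem_actions _ i, ?_⟩
    congr
    funext i
    simp [allocate]

lemma Possible.next {t : ℕ} {h : Hist t} (hh : Possible h) {b : Player → Option (Fin (t + 1))}
    (hb : ∀ i, b i ∈ actions h i) (w : Player) : Possible (h.next ⟨b, allocate b w⟩) :=
  ⟨hh, b, w, hb, rfl⟩

lemma eq_none_of_allocate_eq_none {t : ℕ} {b : Player → Option (Fin t)} {w : Player}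
    (h : ∀ i, allocate b w i = none) : b = fun _ => none := by
  have hw := h w
  have ho := h (opp w)
  simp only [allocate, ne_eq, not_true_eq_false, and_false, if_false] at hw
  by_cases hb : b 0 = b 1
  · funext i
    have : b i = b w := by revert i w; simp [Fin.forall_fin_two, hb]
    rw [this, hw]
  · funext i
    by_cases hi : i = w
    · rw [hi, hw]
    · simpa [allocate, hb] using h i

/-- Whenever somebody bids, somebody is served and leaves; so if nobody has left, nobody ever bid.
-/
lemma eq_passHist {t : ℕ} {h : Hist t} (hh : Possible h) (hp : present h = Finset.univ) :
    h = passHist t := by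
  induction h with
  | start => rfl
  | next h o ih =>
    obtain ⟨hh, b, w, hb, rfl⟩ := hh
    have h1 : ∀ i, i ∈ present h ∧ allocate b w i = none := by
      intro i
      have : i ∈ present (h.next ⟨b, allocate b w⟩) := by rw [hp]; simp
      simpa [present] using this
    have h2 := ih hh (Finset.eq_univ_of_forall fun i => (h1 i).1)
    have h3 := eq_none_of_allocate_eq_none fun i => (h1 i).2
    have h4 : allocate b w = fun _ => none := funext fun i => (h1 i).2
    rw [h4, h3, h2]
    rfl

lemma allocate_of_ne {t : ℕ} {b : Player → Option (Fin t)} (h : b 0 ≠ b 1) (w : Player) :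
    allocate b w = b := by
  funext i; simp [allocate, h]

lemma allocate_none {t : ℕ} (w : Player) :
    allocate (fun _ => (none : Option (Fin t))) w = fun _ => none := by
  funext i; simp [allocate]

end Records

/-! ### Continuation values: locality, measurability, boundedness. -/

section Value

variable {F : Measure unitInterval}

/-- Continuation values ignore earlier play, so a deviation confined to one stage leaves all later
values unchanged. -/
lemma value_congr {σ σ' : Profile} (r : ℕ) {t : ℕ}
    (hσ : ∀ s, t ≤ s → ∀ (h : Hist s) x a j, (σ j).prob h x a = (σ' j).prob h x a)
    (h : Hist t) (x : Fin (t + 1) → unitInterval) (i : Player) :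
    value F σ r h x i = value F σ' r h x i := by
  induction r generalizing t with
  | zero => rfl
  | succ r ih =>
    have ih' := fun h x => ih (t := t + 1) (fun s hs => hσ s (by omega)) h x
    simp only [value, ih', hσ t le_rfl]

/-- The expected gain of player `i` from stage `t + 1` on, when the bids of this stage are `b`. -/
noncomputable def gainOfBids (F : Measure unitInterval) (σ : Profile) (r : ℕ) {t : ℕ} (h : Hist t)
    (x : Fin (t + 1) → unitInterval) (b : Player → Option (Fin (t + 1))) (i : Player) : ℝ :=
  ∑ w : Player, (1 / 2 : ℝ) * (gain x (allocate b w i) +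
    ∫ y, value F σ r (h.next ⟨b, allocate b w⟩) (Fin.snoc x y : Fin (t + 2) → unitInterval) i ∂F)

lemma value_succ (σ : Profile) (r : ℕ) {t : ℕ} (h : Hist t) (x : Fin (t + 1) → unitInterval)
    (i : Player) : value F σ (r + 1) h x i =
      ∑ b : Player → Option (Fin (t + 1)), (∏ j, (σ j).prob h x (b j)) * gainOfBids F σ r h x b i :=
  rfl

lemma sum_prod_prob (σ : Profile) {t : ℕ} (h : Hist t) (x : Fin (t + 1) → unitInterval) :
    ∑ b : Player → Option (Fin (t + 1)), ∏ j, (σ j).prob h x (b j) = 1 := by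
  have := Finset.prod_univ_sum (fun _ : Player => (Finset.univ : Finset (Option (Fin (t + 1)))))
    (fun j a => (σ j).prob h x a)
  rw [Fintype.piFinset_univ] at this
  rw [← this]
  simp [(σ _).prob_sum]

lemma prod_prob_nonneg (σ : Profile) {t : ℕ} (h : Hist t) (x : Fin (t + 1) → unitInterval)
    (b : Player → Option (Fin (t + 1))) : 0 ≤ ∏ j, (σ j).prob h x (b j) :=
  Finset.prod_nonneg fun j _ => (σ j).prob_nonneg h x _

lemma mem_actions_of_prob_ne_zero {i : Player} (τ : Strategy i) {t : ℕ} {h : Hist t}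
    {x : Fin (t + 1) → unitInterval} {a : Option (Fin (t + 1))} (ha : τ.prob h x a ≠ 0) :
    a ∈ actions h i := by
  by_contra hn
  exact ha (τ.prob_eq_zero h x a hn)

lemma sum_prob_mul_le (σ : Profile) {t : ℕ} (h : Hist t) (x : Fin (t + 1) → unitInterval)
    {f : (Player → Option (Fin (t + 1))) → ℝ} {C : ℝ}
    (hf : ∀ b, (∀ j, (σ j).prob h x (b j) ≠ 0) → f b ≤ C) :
    ∑ b, (∏ j, (σ j).prob h x (b j)) * f b ≤ C := by
  calc _ ≤ ∑ b : Player → Option (Fin (t + 1)), (∏ j, (σ j).prob h x (b j)) * C := by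
        refine Finset.sum_le_sum fun b _ => ?_
        by_cases hb : ∏ j, (σ j).prob h x (b j) = 0
        · rw [hb, zero_mul, zero_mul]
        · exact mul_le_mul_of_nonneg_left
            (hf b fun j => Finset.prod_ne_zero_iff.1 hb j (Finset.mem_univ j))
            (prod_prob_nonneg σ h x b)
    _ = C := by rw [← Finset.sum_mul, sum_prod_prob, one_mul]

lemma sum_prob_mul_eq (σ : Profile) {t : ℕ} (h : Hist t) (x : Fin (t + 1) → unitInterval)
    {f : (Player → Option (Fin (t + 1))) → ℝ} {C : ℝ}
    (hf : ∀ b, (∀ j, (σ j).prob h x (b j) ≠ 0) → f b = C) :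
    ∑ b, (∏ j, (σ j).prob h x (b j)) * f b = C := by
  refine le_antisymm (sum_prob_mul_le σ h x fun b hb => (hf b hb).le) ?_
  have := sum_prob_mul_le σ h x (f := fun b => - f b) (C := - C) fun b hb => by rw [hf b hb]
  simp only [mul_neg, Finset.sum_neg_distrib] at this
  linarith

lemma gain_nonneg {t : ℕ} (x : Fin t → unitInterval) (a : Option (Fin t)) : 0 ≤ gain x a := by
  cases a with
  | none => exact le_rfl
  | some j => exact (x j).2.1

lemma gain_le_one {t : ℕ} (x : Fin t → unitInterval) (a : Option (Fin t)) : gain x a ≤ 1 := by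
  cases a with
  | none => exact zero_le_one
  | some j => exact (x j).2.2

lemma measurable_gain {t : ℕ} (a : Option (Fin t)) :
    Measurable fun x : Fin t → unitInterval => gain x a := by
  cases a with
  | none => exact measurable_const
  | some j => exact measurable_subtype_coe.comp (measurable_pi_apply j)

lemma measurable_snoc {t : ℕ} :
    Measurable fun p : (Fin t → unitInterval) × unitInterval =>
      (Fin.snoc p.1 p.2 : Fin (t + 1) → unitInterval) :=
  (Continuous.finSnoc continuous_fst continuous_snd).measurable

variable [IsProbabilityMeasure F]

lemma measurable_value (σ : Profile) (r : ℕ) {t : ℕ} (h : Hist t) (i : Player) :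
    Measurable fun x => value F σ r h x i := by
  induction r generalizing t with
  | zero =>
    have h1 : Measurable fun x : Fin (t + 1) → unitInterval => (best (feasible h) x : ℝ) :=
      (continuous_subtype_val.comp (continuous_best _)).measurable
    have h2 : Measurable fun x : Fin (t + 1) → unitInterval => (secondBest (feasible h) x : ℝ) :=
      (continuous_subtype_val.comp (continuous_secondBest _)).measurable
    simp only [value, lastGain]
    split_ifs
    · exact (h1.add h2).div_const 2
    · exact h1
    · exact measurable_const
  | succ r ih =>
    simp only [value]
    refine Finset.measurable_sum _ fun b _ => Measurable.mul
      (Finset.measurable_prod _ fun j _ => (σ j).measurable_prob h (b j))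
      (Finset.measurable_sum _ fun w _ => measurable_const.mul ((measurable_gain _).add ?_))
    exact (((ih (h.next ⟨b, allocate b w⟩)).comp
      measurable_snoc).stronglyMeasurable.integral_prod_right').measurable

lemma abs_value_le (σ : Profile) (r : ℕ) {t : ℕ} (h : Hist t) (x : Fin (t + 1) → unitInterval)
    (i : Player) : |value F σ r h x i| ≤ r + 1 := by
  -- The bound is crude: it allows a gain of one at every stage, without using that a player who got
  -- an item leaves. Only integrability is needed.
  have key : 0 ≤ value F σ r h x i ∧ value F σ r h x i ≤ r + 1 := by
    induction r generalizing t with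
    | zero =>
      have h1 := (best (feasible h) x).2
      have h2 := (secondBest (feasible h) x).2
      simp only [Set.mem_Icc] at h1 h2
      simp only [value, lastGain]
      split_ifs <;> constructor <;> norm_num <;> linarith
    | succ r ih =>
      have hg : ∀ b, 0 ≤ gainOfBids F σ r h x b i ∧ gainOfBids F σ r h x b i ≤ (r + 1 : ℕ) + 1 := by
        intro b
        have hw : ∀ w, 0 ≤ ∫ y, value F σ r (h.next ⟨b, allocate b w⟩)
              (Fin.snoc x y : Fin (t + 2) → unitInterval) i ∂F ∧
            ∫ y, value F σ r (h.next ⟨b, allocate b w⟩)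
              (Fin.snoc x y : Fin (t + 2) → unitInterval) i ∂F ≤ r + 1 := by
          intro w
          refine ⟨integral_nonneg fun y => (ih _ _).1, ?_⟩
          have hint : Integrable (fun y => value F σ r (h.next ⟨b, allocate b w⟩)
              (Fin.snoc x y : Fin (t + 2) → unitInterval) i) F :=
            integrable_of_abs_le (C := r + 1) ((measurable_value σ r _ i).comp
              (measurable_snoc.comp measurable_prodMk_left))
              fun y => by rw [abs_of_nonneg (ih _ _).1]; exact (ih _ _).2
          refine (integral_mono hint (integrable_const _) fun y => (ih _ _).2).trans ?_
          simp
        unfold gainOfBids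
        rw [Fin.sum_univ_two]
        have h0 := hw 0
        have h1 := hw 1
        have g0 := gain_nonneg x (allocate b 0 i)
        have g1 := gain_nonneg x (allocate b 1 i)
        have g0' := gain_le_one x (allocate b 0 i)
        have g1' := gain_le_one x (allocate b 1 i)
        push_cast
        constructor <;> linarith
      rw [value_succ]
      exact ⟨Finset.sum_nonneg fun b _ => mul_nonneg (prod_prob_nonneg σ h x b) (hg b).1,
        sum_prob_mul_le σ h x fun b _ => (hg b).2⟩
  rw [abs_of_nonneg key.1]
  exact key.2

lemma integrable_value_snoc (σ : Profile) (r : ℕ) {t : ℕ} (h : Hist t) (x : Fin t → unitInterval)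
    (i : Player) :
    Integrable (fun y => value F σ r h (Fin.snoc x y : Fin (t + 1) → unitInterval) i) F :=
  integrable_of_abs_le ((measurable_value σ r h i).comp
    (measurable_snoc.comp measurable_prodMk_left)) fun _ => abs_value_le σ r h _ i

end Value

/-! ### A player left alone. -/

section Solo

variable {F : Measure unitInterval}

lemma notMem_present_next {t : ℕ} {h : Hist t} {o : Outcome (t + 1)} {i : Player}
    (hi : i ∉ present h ∨ o.got i ≠ none) : i ∉ present (h.next o) := by
  simp only [present, Finset.mem_filter, not_and_or]
  exact hi

lemma value_eq_zero_of_notMem (σ : Profile) (r : ℕ) {t : ℕ} {h : Hist t}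
    (x : Fin (t + 1) → unitInterval) {i : Player} (hi : i ∉ present h) :
    value F σ r h x i = 0 := by
  induction r generalizing t with
  | zero => simp [value, lastGain, hi]
  | succ r ih =>
    rw [value_succ]
    refine sum_prob_mul_eq σ h x fun b hb => ?_
    have hbi : b i = none := eq_none_of_notMem_present hi (mem_actions_of_prob_ne_zero _ (hb i))
    have : ∀ w, allocate b w i = none := fun w => by simp [allocate, hbi]
    simp [gainOfBids, this, gain, ih _ (notMem_present_next (Or.inl hi))]

lemma gainOfBids_of_ne (σ : Profile) (r : ℕ) {t : ℕ} (h : Hist t)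
    (x : Fin (t + 1) → unitInterval) {b : Player → Option (Fin (t + 1))} (hb : b 0 ≠ b 1)
    (i : Player) : gainOfBids F σ r h x b i = gain x (b i) +
      ∫ y, value F σ r (h.next ⟨b, b⟩) (Fin.snoc x y : Fin (t + 2) → unitInterval) i ∂F := by
  simp only [gainOfBids, allocate_of_ne hb, Fin.sum_univ_two]
  ring

lemma gainOfBids_none (σ : Profile) (r : ℕ) {t : ℕ} (h : Hist t)
    (x : Fin (t + 1) → unitInterval) (i : Player) : gainOfBids F σ r h x (fun _ => none) i =
      ∫ y, value F σ r (h.next ⟨fun _ => none, fun _ => none⟩)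
        (Fin.snoc x y : Fin (t + 2) → unitInterval) i ∂F := by
  simp only [gainOfBids, allocate_none, Fin.sum_univ_two, gain]
  ring

lemma ne_of_ne_opp {α : Type*} {b : Player → α} {i : Player} (h : b i ≠ b (opp i)) :
    b 0 ≠ b 1 := by
  revert h
  fin_cases i
  · exact id
  · exact fun h => h.symm

lemma eq_of_eq_opp {α : Type*} {b : Player → α} {i : Player} (h : b i = b (opp i)) :
    b 0 = b 1 := by
  revert h
  fin_cases i
  · exact id
  · exact fun h => h.symm

lemma present_next_none {t : ℕ} (h : Hist t) (b : Player → Option (Fin (t + 1))) :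
    present (h.next ⟨b, fun _ => none⟩) = present h := by
  simp [present]

lemma best_feasible_next_none {t : ℕ} (h : Hist t) (b : Player → Option (Fin (t + 1)))
    (x : Fin (t + 1) → unitInterval) (y : unitInterval) :
    best (feasible (h.next ⟨b, fun _ => none⟩)) (Fin.snoc x y : Fin (t + 2) → unitInterval) =
      best (feasible h) x ⊔ y := by
  have : (feasible h).filter (fun j => ∀ i : Player, (none : Option (Fin (t + 1))) ≠ some j) =
      feasible h := by simp
  simp only [feasible]
  rw [this, best_insert_last]

/-- The absent opponent can only pass, so there is no competition: either the player leaves with the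
chosen item and earns nothing more, or nothing happens at this stage. -/
lemma gainOfBids_solo (σ : Profile) (r : ℕ) {t : ℕ} {h : Hist t}
    (x : Fin (t + 1) → unitInterval) {i : Player} (hp : present h = {i})
    {b : Player → Option (Fin (t + 1))} (hb : ∀ j, b j ∈ actions h j) :
    (∃ k ∈ feasible h, b i = some k ∧ gainOfBids F σ r h x b i = x k) ∨
      (b i = none ∧ gainOfBids F σ r h x b i =
        ∫ y, value F σ r (h.next ⟨fun _ => none, fun _ => none⟩)
          (Fin.snoc x y : Fin (t + 2) → unitInterval) i ∂F) := by
  have ho : b (opp i) = none :=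
    eq_none_of_notMem_present (by rw [hp]; simpa using opp_ne i) (hb (opp i))
  cases hbi : b i with
  | none =>
    have : b = fun _ => none := by
      funext j
      by_cases hj : j = i
      · rw [hj, hbi]
      · rw [eq_opp_of_ne hj, ho]
    exact Or.inr ⟨rfl, by rw [this, gainOfBids_none]⟩
  | some k =>
    refine Or.inl ⟨k, ?_, rfl, ?_⟩
    · have := hb i
      rw [hbi] at this
      simpa [actions, hp] using this
    · rw [gainOfBids_of_ne σ r h x (ne_of_ne_opp (i := i) (by rw [hbi, ho]; simp)), hbi]
      have : i ∉ present (h.next ⟨b, b⟩) := notMem_present_next (Or.inr (by simp [hbi]))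
      simp [value_eq_zero_of_notMem σ r _ this, gain]

lemma lastGain_solo {t : ℕ} {h : Hist t} (x : Fin (t + 1) → unitInterval) {i : Player}
    (hp : present h = {i}) : lastGain h x i = best (feasible h) x := by
  have : ({i} : Finset Player) ≠ Finset.univ := by clear hp; revert i; decide
  simp [lastGain, hp, this]

variable [IsProbabilityMeasure F]

lemma integral_expMax_best (r : ℕ) {t : ℕ} (h : Hist t) (x : Fin (t + 1) → unitInterval)
    (b : Player → Option (Fin (t + 1))) :
    ∫ y, expMax F r (best (feasible (h.next ⟨b, fun _ => none⟩))
      (Fin.snoc x y : Fin (t + 2) → unitInterval)) ∂F = expMax F (r + 1) (best (feasible h) x) := by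
  simp_rw [best_feasible_next_none]
  rw [expMax_succ]

lemma integrable_expMax_best_snoc (r : ℕ) {t : ℕ} (A : Finset (Fin (t + 1)))
    (x : Fin t → unitInterval) :
    Integrable (fun y => expMax F r (best A (Fin.snoc x y : Fin (t + 1) → unitInterval))) F :=
  integrable_expMax_comp F ((continuous_best A).measurable.comp
    (measurable_snoc.comp measurable_prodMk_left)) r

/-- A player who is alone cannot do better than wait until the end. -/
lemma value_solo_le (σ : Profile) (r : ℕ) {t : ℕ} {h : Hist t} (x : Fin (t + 1) → unitInterval)
    {i : Player} (hp : present h = {i}) :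
    value F σ r h x i ≤ expMax F r (best (feasible h) x) := by
  induction r generalizing t with
  | zero => simp [value, lastGain_solo x hp]
  | succ r ih =>
    rw [value_succ]
    refine sum_prob_mul_le σ h x fun b hb => ?_
    rcases gainOfBids_solo (F := F) σ r x hp fun j => mem_actions_of_prob_ne_zero _ (hb j) with
      ⟨k, hk, -, h1⟩ | ⟨-, h1⟩
    · rw [h1]
      exact le_trans (le_best x hk) (le_expMax F _ _)
    · rw [h1, ← integral_expMax_best r h x fun _ => none]
      exact integral_mono (integrable_value_snoc σ r _ x i) (integrable_expMax_best_snoc r _ x)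
        fun y => ih _ ((present_next_none h _).trans hp)

/-- The strategy passes with probability one as soon as the other player has left. -/
def PassesAlone {i : Player} (τ : Strategy i) : Prop :=
  ∀ {t : ℕ} (h : Hist t) (x : Fin (t + 1) → unitInterval), present h = {i} → τ.prob h x none = 1

lemma prob_eq_zero_of_eq_one {i : Player} (τ : Strategy i) {t : ℕ} {h : Hist t}
    {x : Fin (t + 1) → unitInterval} {a b : Option (Fin (t + 1))} (ha : τ.prob h x a = 1)
    (hb : b ≠ a) : τ.prob h x b = 0 := by
  have h1 := τ.prob_sum h x
  rw [← Finset.add_sum_erase _ _ (Finset.mem_univ a), ha] at h1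
  have h2 : ∑ c ∈ Finset.univ.erase a, τ.prob h x c = 0 := by linarith
  exact (Finset.sum_eq_zero_iff_of_nonneg fun c _ => τ.prob_nonneg h x c).1 h2 b
    (Finset.mem_erase.2 ⟨hb, Finset.mem_univ _⟩)

lemma value_solo_eq (σ : Profile) (r : ℕ) {t : ℕ} {h : Hist t} (x : Fin (t + 1) → unitInterval)
    {i : Player} (hσ : PassesAlone (σ i)) (hp : present h = {i}) :
    value F σ r h x i = expMax F r (best (feasible h) x) := by
  induction r generalizing t with
  | zero => simp [value, lastGain_solo x hp]
  | succ r ih =>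
    rw [value_succ]
    refine sum_prob_mul_eq σ h x fun b hb => ?_
    rcases gainOfBids_solo (F := F) σ r x hp fun j => mem_actions_of_prob_ne_zero _ (hb j) with
      ⟨k, hk, hbi, -⟩ | ⟨-, h1⟩
    · exact absurd (prob_eq_zero_of_eq_one (σ i) (hσ h x hp) (by simp [hbi])) (hb i)
    · rw [h1, ← integral_expMax_best r h x fun _ => none]
      congr 1
      funext y
      exact ih _ ((present_next_none h _).trans hp)

end Solo

/-! ### Reduction to a one-stage game. -/

section Stage

/-- The gain of a player in the game of one stage, if his bid is `a` and the other one's is `c`: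
`z` is his gain when both pass, `x k` the value of item `k` and `y k` his gain if the other player
leaves with item `k`. -/
noncomputable def stageGain {t : ℕ} (z : ℝ) (x y : Fin t → ℝ) : Option (Fin t) → Option (Fin t) → ℝ
  | none, none => z
  | none, some k => y k
  | some j, none => x j
  | some j, some k => if j = k then (x j + y j) / 2 else x j

/-- The entry `y k` matters only when the other player can leave with `k` while this one stays,
hence the restricted hypothesis on `y`. -/
lemma stageGain_mono {t : ℕ} {z z' : ℝ} {x y y' : Fin t → ℝ} {a c : Option (Fin t)} (hz : z ≤ z')
    (hy : ∀ k, c = some k → a = none ∨ a = c → y k ≤ y' k) :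
    stageGain z x y a c ≤ stageGain z' x y' a c := by
  rcases a with _ | j <;> rcases c with _ | k
  · exact hz
  · exact hy k rfl (Or.inl rfl)
  · exact le_rfl
  · simp only [stageGain]
    split_ifs with h
    · subst h
      linarith [hy j rfl (Or.inr rfl)]
    · exact le_rfl

/-- The gain of a player who waits alone after the other one left with item `k`. -/
noncomputable def waitGain (F : Measure unitInterval) (r : ℕ) {t : ℕ} (x : Fin t → unitInterval)
    (k : Fin t) : ℝ := expMax F r (best (Finset.univ.erase k) x)

variable {F : Measure unitInterval}

/-- The expected gain of player `i` if both players pass at stage `t + 1`, being both present. -/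
noncomputable def passGain (F : Measure unitInterval) (σ : Profile) (r : ℕ) {t : ℕ}
    (x : Fin (t + 1) → unitInterval) (i : Player) : ℝ :=
  ∫ y, value F σ r (passHist (t + 1)) (Fin.snoc x y : Fin (t + 2) → unitInterval) i ∂F

/-- The record with the coin given to `opp i` is the right one in every case where player `i` stays
and the opponent leaves: for equal bids that is the coin that lets the opponent leave, and for
different bids the coin is irrelevant. -/
lemma gainOfBids_passHist (σ : Profile) (r : ℕ) {t : ℕ} (x : Fin (t + 1) → unitInterval)
    (b : Player → Option (Fin (t + 1))) (i : Player) :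
    gainOfBids F σ r (passHist t) x b i =
      stageGain (passGain F σ r x i) (fun k => x k)
        (fun _ => ∫ y, value F σ r ((passHist t).next ⟨b, allocate b (opp i)⟩)
          (Fin.snoc x y : Fin (t + 2) → unitInterval) i ∂F) (b i) (b (opp i)) := by
  by_cases hb : b i = b (opp i)
  · have hb' := eq_of_eq_opp hb
    rcases hbi : b i with _ | j
    · have : b = fun _ => none := by
        funext j
        by_cases hj : j = i
        · rw [hj, hbi]
        · rw [eq_opp_of_ne hj, ← hb, hbi]
      rw [← hb, hbi, this, gainOfBids_none]
      rfl
    · rw [← hb, hbi]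
      have hi : allocate b i i = some j := by simp [allocate, hbi]
      have ho : allocate b (opp i) i = none := by simp [allocate, hb', (opp_ne i).symm]
      have h1 : i ∉ present ((passHist t).next ⟨b, allocate b i⟩) :=
        notMem_present_next (Or.inr (by simp [hi]))
      have hsum : ∀ f : Player → ℝ, ∑ w, f w = f i + f (opp i) := by
        intro f
        rw [Fin.sum_univ_two]
        fin_cases i
        · rfl
        · exact add_comm _ _
      simp only [gainOfBids, hsum, hi, ho, gain, value_eq_zero_of_notMem σ r _ h1, stageGain,
        integral_zero, if_true]
      ring
  · have hb' := ne_of_ne_opp hb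
    rw [gainOfBids_of_ne σ r _ x hb']
    rcases hbi : b i with _ | j
    · rcases hbo : b (opp i) with _ | k
      · exact absurd (hbi.trans hbo.symm) hb
      · simp [stageGain, gain, allocate_of_ne hb']
    · have h1 : i ∉ present ((passHist t).next ⟨b, b⟩) :=
        notMem_present_next (Or.inr (by simp [hbi]))
      simp only [value_eq_zero_of_notMem σ r _ h1, integral_zero, add_zero]
      rcases hbo : b (opp i) with _ | k
      · rfl
      · rw [stageGain, if_neg]
        · rfl
        · rintro rfl
          exact hb (hbi.trans hbo.symm)

/-- After every possible record in which player `i` is alone, his payoff is that of waiting. -/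
def WaitsAlone (F : Measure unitInterval) (σ : Profile) (r t : ℕ) (i : Player) : Prop :=
  ∀ h : Hist t, Possible h → present h = {i} → ∀ x : Fin (t + 1) → unitInterval,
    value F σ r h x i = expMax F r (best (feasible h) x)

lemma allocate_opp {t : ℕ} {b : Player → Option (Fin (t + 1))} {i : Player} {k : Fin (t + 1)}
    (hk : b (opp i) = some k) (ha : b i = none ∨ b i = b (opp i)) :
    allocate b (opp i) i = none ∧ allocate b (opp i) (opp i) = some k := by
  refine ⟨?_, by simp [allocate, hk]⟩
  rcases ha with ha | ha
  · simp [allocate, ha]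
  · simp [allocate, eq_of_eq_opp ha, (opp_ne i).symm]

lemma present_next_passHist {t : ℕ} {i : Player} {o : Outcome (t + 1)} {k : Fin (t + 1)}
    (hi : o.got i = none) (ho : o.got (opp i) = some k) :
    present ((passHist t).next o) = {i} := by
  ext j
  by_cases hj : j = i
  · simp [present, hj, hi]
  · simp [present, eq_opp_of_ne hj, ho, opp_ne]

lemma best_feasible_next_passHist {t : ℕ} {i : Player} {o : Outcome (t + 1)} {k : Fin (t + 1)}
    (hi : o.got i = none) (ho : o.got (opp i) = some k) (x : Fin (t + 1) → unitInterval)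
    (y : unitInterval) :
    best (feasible ((passHist t).next o)) (Fin.snoc x y : Fin (t + 2) → unitInterval) =
      best (Finset.univ.erase k) x ⊔ y := by
  have : (feasible (passHist t)).filter (fun j => ∀ i, o.got i ≠ some j) =
      Finset.univ.erase k := by
    ext j
    simp only [feasible_passHist, Finset.mem_filter, Finset.mem_univ, true_and, Finset.mem_erase,
      and_true]
    constructor
    · rintro h rfl
      exact h _ ho
    · intro h l
      by_cases hl : l = i
      · simp [hl, hi]
      · simpa [eq_opp_of_ne hl, ho] using fun h' => h h'.symm
  simp only [feasible]
  rw [this, best_insert_last]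

variable [IsProbabilityMeasure F]

lemma integral_expMax_best_next (r : ℕ) {t : ℕ} {i : Player} {o : Outcome (t + 1)}
    {k : Fin (t + 1)} (hi : o.got i = none) (ho : o.got (opp i) = some k)
    (x : Fin (t + 1) → unitInterval) :
    ∫ y, expMax F r (best (feasible ((passHist t).next o))
      (Fin.snoc x y : Fin (t + 2) → unitInterval)) ∂F = waitGain F (r + 1) x k := by
  simp_rw [best_feasible_next_passHist hi ho]
  rw [waitGain, expMax_succ]

/-- An upper bound valid for arbitrary play, since no continuation alone beats waiting. It controls
deviations; equality holds under `WaitsAlone`. -/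
lemma gainOfBids_passHist_le (σ : Profile) (r : ℕ) {t : ℕ} (x : Fin (t + 1) → unitInterval)
    (b : Player → Option (Fin (t + 1))) (i : Player) {z : ℝ} (hz : passGain F σ r x i ≤ z) :
    gainOfBids F σ r (passHist t) x b i ≤
      stageGain z (fun k => x k) (waitGain F (r + 1) x) (b i) (b (opp i)) := by
  rw [gainOfBids_passHist]
  refine stageGain_mono hz fun k hk ha => ?_
  obtain ⟨h1, h2⟩ := allocate_opp hk ha
  rw [← integral_expMax_best_next r (o := ⟨b, allocate b (opp i)⟩) h1 h2]
  exact integral_mono (integrable_value_snoc σ r _ x i) (integrable_expMax_best_snoc r _ x)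
    fun y => value_solo_le σ r _ (present_next_passHist h1 h2)

lemma gainOfBids_passHist_eq {σ : Profile} {r t : ℕ} {i : Player}
    (hσ : WaitsAlone F σ r (t + 1) i) (x : Fin (t + 1) → unitInterval)
    (b : Player → Option (Fin (t + 1))) :
    gainOfBids F σ r (passHist t) x b i =
      stageGain (passGain F σ r x i) (fun k => x k) (waitGain F (r + 1) x) (b i) (b (opp i)) := by
  have key : ∀ k, b (opp i) = some k → b i = none ∨ b i = b (opp i) →
      ∫ y, value F σ r ((passHist t).next ⟨b, allocate b (opp i)⟩)
        (Fin.snoc x y : Fin (t + 2) → unitInterval) i ∂F = waitGain F (r + 1) x k := by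
    intro k hk ha
    obtain ⟨h1, h2⟩ := allocate_opp hk ha
    rw [← integral_expMax_best_next r (o := ⟨b, allocate b (opp i)⟩) h1 h2]
    congr 1
    funext y
    exact hσ _ ((possible_passHist t).next (by simp) _) (present_next_passHist h1 h2) _
  rw [gainOfBids_passHist]
  exact le_antisymm (stageGain_mono le_rfl fun k hk ha => (key k hk ha).le)
    (stageGain_mono le_rfl fun k hk ha => (key k hk ha).ge)

lemma sum_bids {α : Type*} [Fintype α] (p : Player → α → ℝ) (f : α → α → ℝ) (i : Player) :
    ∑ b : Player → α, (∏ j, p j (b j)) * f (b i) (b (opp i)) =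
      ∑ a, ∑ c, p i a * p (opp i) c * f a c := by
  rw [← (finTwoArrowEquiv α).symm.sum_comp, Fintype.sum_prod_type]
  fin_cases i
  · simp [finTwoArrowEquiv, opp]
  · rw [Finset.sum_comm]
    refine Finset.sum_congr rfl fun a _ => Finset.sum_congr rfl fun c _ => ?_
    simp [finTwoArrowEquiv, opp, mul_comm]

lemma value_passHist_le (σ : Profile) (r : ℕ) {t : ℕ} (x : Fin (t + 1) → unitInterval)
    (i : Player) {z : ℝ} (hz : passGain F σ r x i ≤ z) :
    value F σ (r + 1) (passHist t) x i ≤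
      ∑ a, ∑ c, (σ i).prob (passHist t) x a * (σ (opp i)).prob (passHist t) x c *
        stageGain z (fun k => x k) (waitGain F (r + 1) x) a c := by
  rw [value_succ, ← sum_bids (fun j a => (σ j).prob (passHist t) x a)]
  exact Finset.sum_le_sum fun b _ => mul_le_mul_of_nonneg_left
    (gainOfBids_passHist_le σ r x b i hz) (prod_prob_nonneg σ _ x b)

lemma value_passHist_eq {σ : Profile} {r t : ℕ} {i : Player} (hσ : WaitsAlone F σ r (t + 1) i)
    (x : Fin (t + 1) → unitInterval) :
    value F σ (r + 1) (passHist t) x i =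
      ∑ a, ∑ c, (σ i).prob (passHist t) x a * (σ (opp i)).prob (passHist t) x c *
        stageGain (passGain F σ r x i) (fun k => x k) (waitGain F (r + 1) x) a c := by
  rw [value_succ, ← sum_bids (fun j a => (σ j).prob (passHist t) x a)]
  exact Finset.sum_congr rfl fun b _ => by rw [gainOfBids_passHist_eq hσ]

end Stage

/-! ### Pure bidding strategies and one-stage modifications. -/

section Strategies

open Classical in
/-- The strategy that plays the pure action prescribed by `c`. -/
noncomputable def pureStrategy (i : Player)
    (c : (t : ℕ) → Hist t → (Fin (t + 1) → unitInterval) → Option (Fin (t + 1)))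
    (hc : ∀ t h x, c t h x ∈ actions h i)
    (hm : ∀ t h a, MeasurableSet {x | c t h x = a}) : Strategy i where
  prob {t} h x a := if c t h x = a then 1 else 0
  prob_nonneg h x a := by split_ifs <;> norm_num
  prob_sum h x := by simp
  prob_eq_zero {t} h x a ha := if_neg fun hca => ha (by rw [← hca]; exact hc t h x)
  measurable_prob {t} h a := Measurable.ite (hm t h a) measurable_const measurable_const

open Classical in
/-- Bid for the best item if nobody has left and the values of the samples are in `C t`; pass
otherwise. -/
noncomputable def bidChoice (C : (t : ℕ) → Set (Fin (t + 1) → unitInterval)) (t : ℕ) (h : Hist t)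
    (x : Fin (t + 1) → unitInterval) : Option (Fin (t + 1)) :=
  if h = passHist t ∧ x ∈ C t then some (bestItem x) else none

lemma measurableSet_bidChoice_eq {C : (t : ℕ) → Set (Fin (t + 1) → unitInterval)}
    (hC : ∀ t, MeasurableSet (C t)) (t : ℕ) (h : Hist t) (a : Option (Fin (t + 1))) :
    MeasurableSet {x | bidChoice C t h x = a} := by
  by_cases hh : h = passHist t
  · cases a with
    | none =>
      have : {x | bidChoice C t h x = none} = (C t)ᶜ := by
        ext x; simp [bidChoice, hh]
      rw [this]
      exact (hC t).compl
    | some j =>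
      have : {x | bidChoice C t h x = some j} = C t ∩ {x | bestItem x = j} := by
        ext x; simp [bidChoice, hh]
      rw [this]
      exact (hC t).inter (measurableSet_bestItem_eq j)
  · have : {x | bidChoice C t h x = a} = {_x | none = a} := by
      ext x; simp [bidChoice, hh]
    rw [this]
    exact MeasurableSet.const _

/-- The strategy that plays `bidChoice C`. -/
noncomputable def bidStrategy (C : (t : ℕ) → Set (Fin (t + 1) → unitInterval))
    (hC : ∀ t, MeasurableSet (C t)) (i : Player) : Strategy i :=
  pureStrategy i (bidChoice C)
    (fun t h x => by
      by_cases hh : h = passHist t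
      · simp [hh]
      · simpa [bidChoice, hh] using none_mem_actions h i)
    (measurableSet_bidChoice_eq hC)

variable {C : (t : ℕ) → Set (Fin (t + 1) → unitInterval)} (hC : ∀ t, MeasurableSet (C t))
  (i : Player)

lemma bidStrategy_prob_some {t : ℕ} {x : Fin (t + 1) → unitInterval} (hx : x ∈ C t) :
    (bidStrategy C hC i).prob (passHist t) x (some (bestItem x)) = 1 := by
  simp [bidStrategy, pureStrategy, bidChoice, hx]

lemma bidStrategy_prob_none {t : ℕ} {x : Fin (t + 1) → unitInterval} (hx : x ∉ C t) :
    (bidStrategy C hC i).prob (passHist t) x none = 1 := by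
  simp [bidStrategy, pureStrategy, bidChoice, hx]

lemma singleton_ne_univ : ({i} : Finset Player) ≠ Finset.univ := by revert i; decide

lemma passesAlone_bidStrategy : PassesAlone (bidStrategy C hC i) := by
  intro t h x hp
  have : h ≠ passHist t := by
    rintro rfl
    rw [present_passHist] at hp
    exact singleton_ne_univ i hp.symm
  simp [bidStrategy, pureStrategy, bidChoice, this]

/-- The strategy that plays `τ` at stage `t + 1` and `σ` at the other stages. -/
def patch {i : Player} (σ τ : Strategy i) (t : ℕ) : Strategy i where
  prob {s} h x a := if s = t then τ.prob h x a else σ.prob h x a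
  prob_nonneg h x a := by
    split_ifs
    · exact τ.prob_nonneg h x a
    · exact σ.prob_nonneg h x a
  prob_sum h x := by
    split_ifs
    · exact τ.prob_sum h x
    · exact σ.prob_sum h x
  prob_eq_zero h x a ha := by
    split_ifs
    · exact τ.prob_eq_zero h x a ha
    · exact σ.prob_eq_zero h x a ha
  measurable_prob h a := by
    split_ifs
    · exact τ.measurable_prob h a
    · exact σ.measurable_prob h a

end Strategies

/-! ### Deviations from an equilibrium. -/

section Deviations

variable {F : Measure unitInterval} [IsProbabilityMeasure F]

/-- Never bidding guarantees a lone player the payoff of waiting, which is also the most obtainable.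
Subgame perfection imposes this after every possible record. -/
lemma IsSPE.waitsAlone {n : ℕ} {σ : Profile} (hσ : IsSPE F n σ) {t r : ℕ} (h : t + 1 + r = n)
    (i : Player) : WaitsAlone F σ r t i := by
  intro h' hh hp x
  refine le_antisymm (value_solo_le σ r x hp) ?_
  have h1 := (hσ t r h h' hh i (bidStrategy (fun _ => ∅) (fun _ => .empty) i)).2 x
  rwa [value_solo_eq _ r x (by rw [Function.update_self]; exact passesAlone_bidStrategy _ i) hp] at h1

lemma sum_mul_of_eq_one {i : Player} (τ : Strategy i) {t : ℕ} {h : Hist t}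
    {x : Fin (t + 1) → unitInterval} {a : Option (Fin (t + 1))} (ha : τ.prob h x a = 1)
    (f : Option (Fin (t + 1)) → ℝ) : ∑ b, τ.prob h x b * f b = f a := by
  rw [Finset.sum_eq_single a (fun b _ hb => by rw [prob_eq_zero_of_eq_one τ ha hb, zero_mul])
    (by simp), ha, one_mul]

/-- One-shot deviation: `τ` is used at stage `t + 1` only, so the continuation payoffs are those of
`σ`, and the left side is what the deviation earns. -/
lemma IsSPE.stageGain_le {n : ℕ} {σ : Profile} (hσ : IsSPE F n σ) {t r : ℕ}
    (h : t + 1 + (r + 1) = n) (x : Fin (t + 1) → unitInterval) (i : Player) (τ : Strategy i)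
    {a : Option (Fin (t + 1))} (ha : τ.prob (passHist t) x a = 1) :
    ∑ c, (σ (opp i)).prob (passHist t) x c *
        stageGain (passGain F σ r x i) (fun k => x k) (waitGain F (r + 1) x) a c ≤
      value F σ (r + 1) (passHist t) x i := by
  set ρ : Profile := Function.update σ i (patch (σ i) τ t) with hρ
  have hsame : ∀ s, t + 1 ≤ s → ∀ (h : Hist s) x a j, (ρ j).prob h x a = (σ j).prob h x a := by
    intro s hs h x a j
    by_cases hj : j = i
    · subst hj
      simp [hρ, patch, show s ≠ t by omega]
    · simp [hρ, hj]
  have hval := fun (h : Hist (t + 1)) x => value_congr (F := F) r hsame h x i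
  have hwait : WaitsAlone F ρ r (t + 1) i := fun h' hh hp x' => by
    rw [hval]; exact hσ.waitsAlone (by omega) i h' hh hp x'
  have hpass : passGain F ρ r x i = passGain F σ r x i := by simp only [passGain, hval]
  have h1 := (hσ t (r + 1) h (passHist t) (possible_passHist t) i (patch (σ i) τ t)).2 x
  rw [← hρ, value_passHist_eq hwait, hpass] at h1
  have h2 : (ρ i).prob (passHist t) x a = 1 := by simpa [hρ, patch] using ha
  have h3 : ρ (opp i) = σ (opp i) := by simp [hρ, opp_ne]
  rw [h3] at h1
  simp only [mul_assoc, ← Finset.mul_sum] at h1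
  rwa [sum_mul_of_eq_one _ h2] at h1

end Deviations

/-! ### Equilibria of the one-stage game. -/

section StageEquilibrium

/-- Actions that are worse than the best ones are not played if their mixture is optimal. -/
lemma weight_eq_zero_of_lt {α : Type*} [Fintype α] {p g : α → ℝ} {M : ℝ} (hp : ∀ a, 0 ≤ p a)
    (hsum : ∑ a, p a = 1) (hg : ∀ a, g a ≤ M) (hM : M ≤ ∑ a, p a * g a) {a : α} (ha : g a < M) :
    p a = 0 := by
  have h1 : ∑ b, p b * (M - g b) ≤ 0 := by
    simp only [mul_sub, Finset.sum_sub_distrib, ← Finset.sum_mul, hsum]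
    linarith
  have h2 : ∀ b ∈ Finset.univ, 0 ≤ p b * (M - g b) := fun b _ =>
    mul_nonneg (hp b) (sub_nonneg.2 (hg b))
  have h3 := (Finset.sum_eq_zero_iff_of_nonneg h2).1 (le_antisymm h1 (Finset.sum_nonneg h2)) a
    (Finset.mem_univ a)
  rcases mul_eq_zero.1 h3 with h | h
  · exact h
  · linarith

variable {t : ℕ} {x y : Fin t → ℝ} {z : ℝ} {j : Fin t}

/-- If being left alone with the second best item is better than the best item, then passing
dominates. -/
lemma stageGain_lt_of_lt (hx : ∀ k, x k ≤ x j) (hy : ∀ k, y j ≤ y k) (hxy : x j < y j)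
    (hz : (x j + y j) / 2 ≤ z) (k : Fin t) (c : Option (Fin t)) :
    stageGain z x y (some k) c < stageGain z x y none c := by
  have h1 := hx k
  rcases c with _ | c
  · simp only [stageGain]; linarith
  · have h2 := hy c
    simp only [stageGain]
    split_ifs with h
    · subst h; linarith
    · linarith

lemma sum_mul_lt_sum_mul {α : Type*} [Fintype α] {q f g : α → ℝ} (hq : ∀ a, 0 ≤ q a)
    (hfg : ∀ a, f a ≤ g a) {a : α} (ha : q a ≠ 0) (h : f a < g a) :
    ∑ c, q c * f c < ∑ c, q c * g c :=
  Finset.sum_lt_sum (fun c _ => mul_le_mul_of_nonneg_left (hfg c) (hq c))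
    ⟨a, Finset.mem_univ a, mul_lt_mul_of_pos_left h (lt_of_le_of_ne (hq a) (Ne.symm ha))⟩

lemma exists_ne_zero_of_sum_eq_one {α : Type*} [Fintype α] {q : α → ℝ} (hq : ∑ a, q a = 1) :
    ∃ a, q a ≠ 0 := by
  by_contra! h
  simp [h] at hq

lemma eq_one_of_forall_ne {α : Type*} [Fintype α] {q : α → ℝ} (hq : ∑ a, q a = 1)
    {a : α} (h : ∀ b, b ≠ a → q b = 0) : q a = 1 := by
  rw [← hq, Finset.sum_eq_single a (fun b _ hb => h b hb) (by simp)]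

lemma prob_none_eq_one {p q : Option (Fin t) → ℝ} (hp : ∀ a, 0 ≤ p a) (hp1 : ∑ a, p a = 1)
    (hq : ∀ a, 0 ≤ q a) (hq1 : ∑ a, q a = 1)
    (hx : ∀ k, x k ≤ x j) (hy : ∀ k, y j ≤ y k) (hxy : x j < y j) (hz : (x j + y j) / 2 ≤ z)
    (hbest : ∑ c, q c * stageGain z x y none c ≤
      ∑ a, p a * ∑ c, q c * stageGain z x y a c) : p none = 1 := by
  obtain ⟨c, hc⟩ := exists_ne_zero_of_sum_eq_one hq1
  have hlt : ∀ k : Fin t, ∑ c, q c * stageGain z x y (some k) c <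
      ∑ c, q c * stageGain z x y none c := fun k =>
    sum_mul_lt_sum_mul hq (fun c => (stageGain_lt_of_lt hx hy hxy hz k c).le) hc
      (stageGain_lt_of_lt hx hy hxy hz k c)
  refine eq_one_of_forall_ne hp1 fun b hb => ?_
  obtain ⟨k, rfl⟩ := Option.ne_none_iff_exists'.1 hb
  refine weight_eq_zero_of_lt hp hp1 (fun a => ?_) hbest (hlt k)
  rcases a with _ | l
  · exact le_rfl
  · exact (hlt l).le

/-- With `y j < x j`, a bid for an item other than `j` is at most as good as passing, strictly worse
unless the opponent bids for `j`. If the opponent surely bids for `j`, sharing `j` is strictly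
better. So optimality against `none` and `some j` alone excludes such bids. -/
lemma prob_some_eq_zero {p q : Option (Fin t) → ℝ} (hp : ∀ a, 0 ≤ p a) (hp1 : ∑ a, p a = 1)
    (hq : ∀ a, 0 ≤ q a) (hq1 : ∑ a, q a = 1)
    (hx : ∀ k, k ≠ j → x k ≤ y j) (hy : ∀ k, k ≠ j → x j ≤ y k) (hxy : y j < x j)
    (hz : (x j + y j) / 2 ≤ z)
    (hbest : ∀ a, a = none ∨ a = some j → ∑ c, q c * stageGain z x y a c ≤
      ∑ a, p a * ∑ c, q c * stageGain z x y a c) {k : Fin t} (hk : k ≠ j) : p (some k) = 0 := by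
  set g : Option (Fin t) → ℝ := fun a => ∑ c, q c * stageGain z x y a c with hg
  have hlt : ∀ k, k ≠ j → g (some k) < max (g none) (g (some j)) := by
    intro k hk
    have h1 := hx k hk
    by_cases hqj : ∃ c, c ≠ some j ∧ q c ≠ 0
    · obtain ⟨c, hc, hqc⟩ := hqj
      have hstrict : ∀ c, c ≠ some j →
          stageGain z x y (some k) c < stageGain z x y none c := by
        intro c hc
        rcases c with _ | l
        · simp only [stageGain]; linarith
        · have h2 := hy l (fun h => hc (by rw [h]))
          simp only [stageGain]
          split_ifs with h
          · subst h; linarith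
          · linarith
      refine lt_of_lt_of_le (sum_mul_lt_sum_mul hq (fun c => ?_) hqc (hstrict c hc))
        (le_max_left _ _)
      by_cases h : c = some j
      · subst h
        simpa [stageGain, hk] using h1
      · exact (hstrict c h).le
    · push Not at hqj
      refine lt_of_lt_of_le ?_ (le_max_right _ _)
      have h2 := eq_one_of_forall_ne hq1 hqj
      have h3 : ∀ a, g a = stageGain z x y a (some j) := by
        intro a
        simp only [hg]
        rw [Finset.sum_eq_single (some j) (fun c _ hc => by rw [hqj c hc, zero_mul]) (by simp), h2,
          one_mul]
      rw [h3, h3]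
      simp only [stageGain, hk, if_false, if_true]
      linarith
  refine weight_eq_zero_of_lt hp hp1 (M := max (g none) (g (some j))) (fun a => ?_)
    (max_le (hbest _ (Or.inl rfl)) (hbest _ (Or.inr rfl))) (hlt k hk)
  rcases a with _ | l
  · exact le_max_left _ _
  · by_cases hl : l = j
    · rw [hl]; exact le_max_right _ _
    · exact (hlt l hl).le

lemma sum_option_eq {p : Option (Fin t) → ℝ} (hp : ∀ k, k ≠ j → p (some k) = 0)
    (f : Option (Fin t) → ℝ) : ∑ a, p a * f a = p none * f none + p (some j) * f (some j) := by
  rw [Fintype.sum_option, Finset.sum_eq_single j (fun k _ hk => by rw [hp k hk, zero_mul])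
    (by simp)]

/-- The equilibria of the symmetric game in which both players either pass (gain `z`) or bid for an
item of value `x`, the other one getting `y < x`. -/
lemma two_action_equilibrium {p q z x y v w : ℝ} (hp0 : 0 ≤ p) (hp1 : p ≤ 1) (hq0 : 0 ≤ q)
    (hq1 : q ≤ 1) (hxy : y < x)
    (hv : v = p * (q * z + (1 - q) * y) + (1 - p) * (q * x + (1 - q) * ((x + y) / 2)))
    (hw : w = q * (p * z + (1 - p) * y) + (1 - q) * (p * x + (1 - p) * ((x + y) / 2)))
    (hv1 : q * z + (1 - q) * y ≤ v) (hv2 : q * x + (1 - q) * ((x + y) / 2) ≤ v)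
    (hw1 : p * z + (1 - p) * y ≤ w) (hw2 : p * x + (1 - p) * ((x + y) / 2) ≤ w) :
    v = w ∧ (x + y) / 2 ≤ v ∧ (v = (x + y) / 2 ∨ x ≤ z ∧ v ≤ z) := by
  -- the advantage of passing against `q` and against `p`
  have hq2 : 0 ≤ p * (q * (z - x) - (1 - q) * ((x - y) / 2)) := by linarith
  have hq3 : (1 - p) * (q * (z - x) - (1 - q) * ((x - y) / 2)) ≤ 0 := by linarith
  have hp2 : 0 ≤ q * (p * (z - x) - (1 - p) * ((x - y) / 2)) := by linarith
  have hp3 : (1 - q) * (p * (z - x) - (1 - p) * ((x - y) / 2)) ≤ 0 := by linarith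
  have hd : 0 < (x - y) / 2 := by linarith
  have hlow : (x + y) / 2 ≤ v := by linarith [mul_nonneg hq0 hd.le]
  -- Here `p` and `q` are probabilities of passing. If `z < x`, bidding is strictly better against
  -- every `s`, so both players bid surely.
  rcases lt_or_ge z x with hz | hz
  · have hneg : ∀ s : ℝ, 0 ≤ s → s ≤ 1 → s * (z - x) - (1 - s) * ((x - y) / 2) < 0 := by
      intro s hs0 hs1
      rcases eq_or_lt_of_le hs0 with h | h
      · rw [← h]; linarith
      · linarith [mul_pos h (sub_pos.2 hz), mul_nonneg (sub_nonneg.2 hs1) hd.le]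
    have hp : p = 0 := by
      by_contra h
      linarith [mul_pos (lt_of_le_of_ne hp0 (Ne.symm h)) (neg_pos.2 (hneg q hq0 hq1))]
    have hq : q = 0 := by
      by_contra h
      linarith [mul_pos (lt_of_le_of_ne hq0 (Ne.symm h)) (neg_pos.2 (hneg p hp0 hp1))]
    subst hp hq
    exact ⟨by linarith, hlow, Or.inl (by linarith)⟩
  -- The advantage of passing is strictly increasing in the opponent's probability of passing. If `s
  -- < u`, then `u > 0` makes passing optimal against `s`, while `s < 1` makes bidding optimal
  -- against the larger `u`, a contradiction. Applied both ways this forces `p = q`.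
  · have hle : ∀ s u : ℝ, 0 ≤ s → u ≤ 1 →
        (1 - s) * (u * (z - x) - (1 - u) * ((x - y) / 2)) ≤ 0 →
        0 ≤ u * (s * (z - x) - (1 - s) * ((x - y) / 2)) → u ≤ s := by
      intro s u hs hu h1 h2
      by_contra! hsu
      have h3 : 0 < (u - s) * (z - x + (x - y) / 2) := mul_pos (by linarith) (by linarith)
      have h4 : 0 ≤ s * (z - x) - (1 - s) * ((x - y) / 2) :=
        nonneg_of_mul_nonneg_right h2 (by linarith)
      have h5 : u * (z - x) - (1 - u) * ((x - y) / 2) ≤ 0 :=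
        nonpos_of_mul_nonpos_right h1 (by linarith)
      linarith
    have hpq : p = q := le_antisymm (hle q p hq0 hp1 hp3 hq2) (hle p q hp0 hq1 hq3 hp2)
    subst hpq
    refine ⟨by rw [hv, hw], hlow, Or.inr ⟨hz, ?_⟩⟩
    have h1 : p * z + (1 - p) * y ≤ z := by
      linarith [mul_nonneg (sub_nonneg.2 hp1) (sub_nonneg.2 (hxy.le.trans hz))]
    have h2 : p * x + (1 - p) * ((x + y) / 2) ≤ z := by
      linarith [mul_nonneg (sub_nonneg.2 hp1) hd.le]
    rw [hv]
    linarith [mul_le_mul_of_nonneg_left h1 hp0, mul_le_mul_of_nonneg_left h2 (sub_nonneg.2 hp1)]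

end StageEquilibrium

/-! ### Every equilibrium payoff lies between the bounds. -/

section Necessity

variable {F : Measure unitInterval} {t : ℕ}

lemma waitGain_bestItem (r : ℕ) (x : Fin (t + 1) → unitInterval) :
    waitGain F r x (bestItem x) = expMax F r (secondBest Finset.univ x) := by
  rw [waitGain, best_erase_eq_secondBest x (le_bestItem x)]

lemma value_zero_passHist (σ : Profile) (x : Fin (t + 1) → unitInterval) (i : Player) :
    value F σ 0 (passHist t) x i =
      ((best Finset.univ x : ℝ) + (secondBest Finset.univ x : ℝ)) / 2 := by
  simp [value, lastGain]

variable [IsProbabilityMeasure F]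

lemma waitGain_bestItem_le (r : ℕ) (x : Fin (t + 1) → unitInterval) (k : Fin (t + 1)) :
    waitGain F r x (bestItem x) ≤ waitGain F r x k := by
  rw [waitGain_bestItem]
  exact expMax_mono F r (secondBest_le_best_erase x k)

/-- An opponent who takes any other item leaves the best one behind. -/
lemma bestItem_le_waitGain (r : ℕ) (x : Fin (t + 1) → unitInterval) {k : Fin (t + 1)}
    (hk : k ≠ bestItem x) : (x (bestItem x) : ℝ) ≤ waitGain F r x k := by
  rw [waitGain, best_erase_of_ne_bestItem x hk, ← apply_bestItem]
  exact le_expMax F r _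

lemma le_waitGain_bestItem (r : ℕ) (x : Fin (t + 1) → unitInterval) {k : Fin (t + 1)}
    (hk : k ≠ bestItem x) : (x k : ℝ) ≤ waitGain F r x (bestItem x) := by
  rw [waitGain_bestItem]
  exact le_trans (le_secondBest_of_ne_bestItem x hk) (le_expMax F r _)

/-- Equilibrium payoffs are equal and between the two bounds, at every stage, as long as both players
are present and no indifference occurs. -/
theorem IsSPE.value_passHist (hF : ∀ x, F {x} = 0) {n : ℕ} {σ : Profile} (hσ : IsSPE F n σ)
    (r t : ℕ) (h : t + 1 + r = n) (x : Fin (t + 1) → unitInterval)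
    (hreg : Regular F r (best Finset.univ x) (secondBest Finset.univ x)) :
    value F σ r (passHist t) x 0 = value F σ r (passHist t) x 1 ∧
      low F r (best Finset.univ x) (secondBest Finset.univ x) ≤ value F σ r (passHist t) x 0 ∧
      value F σ r (passHist t) x 0 ≤ high F r (best Finset.univ x) (secondBest Finset.univ x) := by
  induction r generalizing t with
  | zero =>
    simp only [value_zero_passHist, low, high]
    exact ⟨trivial, le_rfl, le_rfl⟩
  | succ r ih =>
    set a := best Finset.univ x with ha
    set b := secondBest Finset.univ x with hb
    have hba : b ≤ a := secondBest_le_best _ _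
    -- The induction hypothesis is available only at regular states, so it passes to the next stage
    -- almost everywhere, which suffices for integrals.
    have hnext : ∀ᵐ y ∂F,
        value F σ r (passHist (t + 1)) (Fin.snoc x y : Fin (t + 2) → unitInterval) 0 =
            value F σ r (passHist (t + 1)) (Fin.snoc x y : Fin (t + 2) → unitInterval) 1 ∧
          low F r (a ⊔ y) (med a b y) ≤
            value F σ r (passHist (t + 1)) (Fin.snoc x y : Fin (t + 2) → unitInterval) 0 ∧
          value F σ r (passHist (t + 1)) (Fin.snoc x y : Fin (t + 2) → unitInterval) 0 ≤
            high F r (a ⊔ y) (med a b y) := by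
      filter_upwards [ae_regular_next hF hba hreg] with y hy
      have := ih (t + 1) (by omega) (Fin.snoc x y)
      rw [best_univ_snoc, secondBest_univ_snoc] at this
      exact this hy
    have hint := integrable_value_snoc (F := F) σ r (passHist (t + 1)) x 0
    have hz01 : passGain F σ r x 1 = passGain F σ r x 0 :=
      integral_congr_ae (hnext.mono fun y hy => hy.1.symm)
    have hzlow : nextLow F r a b ≤ passGain F σ r x 0 :=
      integral_mono_ae (integrable_low_next F r a b) hint (hnext.mono fun y hy => hy.2.1)
    have hzhigh : passGain F σ r x 0 ≤ nextHigh F r a b :=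
      integral_mono_ae hint (integrable_high_next F r a b) (hnext.mono fun y hy => hy.2.2)
    set z := passGain F σ r x 0
    set j := bestItem x with hj
    have hxj : x j = a := apply_bestItem x
    have hyj : waitGain F (r + 1) x j = expMax F (r + 1) b := waitGain_bestItem (r + 1) x
    have hxle : ∀ k, (x k : ℝ) ≤ x j := fun k => le_bestItem x k
    have hz : ((x j : ℝ) + waitGain F (r + 1) x j) / 2 ≤ z := by
      rw [hxj, hyj]; exact (half_le_nextLow F r hba).trans hzlow
    set p := (σ 0).prob (passHist t) x
    set q := (σ 1).prob (passHist t) x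
    have hp : ∀ a, 0 ≤ p a := (σ 0).prob_nonneg _ x
    have hq : ∀ a, 0 ≤ q a := (σ 1).prob_nonneg _ x
    have hp1 : ∑ a, p a = 1 := (σ 0).prob_sum _ x
    have hq1 : ∑ a, q a = 1 := (σ 1).prob_sum _ x
    have hv0 : value F σ (r + 1) (passHist t) x 0 =
        ∑ a, p a * ∑ c, q c * stageGain z (fun k => x k) (waitGain F (r + 1) x) a c := by
      rw [value_passHist_eq (hσ.waitsAlone (by omega) 0) x]
      simp only [mul_assoc, ← Finset.mul_sum]
      rfl
    have hv1 : value F σ (r + 1) (passHist t) x 1 =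
        ∑ a, q a * ∑ c, p c * stageGain z (fun k => x k) (waitGain F (r + 1) x) a c := by
      rw [value_passHist_eq (hσ.waitsAlone (by omega) 1) x, hz01]
      simp only [mul_assoc, ← Finset.mul_sum]
      rfl
    have hbest : ∀ i a, a = none ∨ a = some j →
        ∑ c, (σ (opp i)).prob (passHist t) x c *
          stageGain (passGain F σ r x i) (fun k => x k) (waitGain F (r + 1) x) a c ≤
        value F σ (r + 1) (passHist t) x i := by
      -- The deviations come from never bidding and from always bidding for the best item while both
      -- are present.
      rintro i _ (rfl | rfl)
      · exact hσ.stageGain_le h x i (bidStrategy (fun _ => ∅) (fun _ => .empty) i)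
          (bidStrategy_prob_none _ i (by simp))
      · exact hσ.stageGain_le h x i (bidStrategy (fun _ => Set.univ) (fun _ => .univ) i)
          (bidStrategy_prob_some _ i (by simp))
    have hb0 : ∀ a, a = none ∨ a = some j →
        ∑ c, q c * stageGain z (fun k => x k) (waitGain F (r + 1) x) a c ≤
          ∑ a, p a * ∑ c, q c * stageGain z (fun k => x k) (waitGain F (r + 1) x) a c :=
      fun a ha => hv0 ▸ hbest 0 a ha
    have hb1 : ∀ a, a = none ∨ a = some j →
        ∑ c, p c * stageGain z (fun k => x k) (waitGain F (r + 1) x) a c ≤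
          ∑ a, q a * ∑ c, p c * stageGain z (fun k => x k) (waitGain F (r + 1) x) a c := by
      intro a ha
      have := hbest 1 a ha
      rw [hz01, hv1] at this
      exact this
    -- Regularity at the full horizon excludes indifference between the best item and waiting with
    -- the second best.
    rcases lt_or_gt_of_ne (hreg (r + 1) (by omega) le_rfl) with hlt | hgt
    · have hxy : (x j : ℝ) < waitGain F (r + 1) x j := by rw [hxj, hyj]; exact hlt
      have hpn := prob_none_eq_one hp hp1 hq hq1 hxle (waitGain_bestItem_le (r + 1) x) hxy hz
        (hb0 none (Or.inl rfl))
      have hqn := prob_none_eq_one hq hq1 hp hp1 hxle (waitGain_bestItem_le (r + 1) x) hxy hz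
        (hb1 none (Or.inl rfl))
      have e0 : value F σ (r + 1) (passHist t) x 0 = z := by
        rw [hv0, sum_mul_of_eq_one (σ 0) hpn, sum_mul_of_eq_one (σ 1) hqn]; rfl
      have e1 : value F σ (r + 1) (passHist t) x 1 = z := by
        rw [hv1, sum_mul_of_eq_one (σ 1) hqn, sum_mul_of_eq_one (σ 0) hpn]; rfl
      rw [e0, e1, low_succ, high_succ, L, H, if_pos hlt.le,
        if_neg (not_lt.2 (hlt.le.trans (le_max_left _ _)))]
      exact ⟨rfl, hzlow, hzhigh⟩
    · have hxy : waitGain F (r + 1) x j < x j := by rw [hxj, hyj]; exact hgt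
      have hp0 : ∀ k, k ≠ j → p (some k) = 0 := fun k hk =>
        prob_some_eq_zero hp hp1 hq hq1 (fun k hk => le_waitGain_bestItem (r + 1) x hk)
          (fun k hk => bestItem_le_waitGain (r + 1) x hk) hxy hz hb0 hk
      have hq0 : ∀ k, k ≠ j → q (some k) = 0 := fun k hk =>
        prob_some_eq_zero hq hq1 hp hp1 (fun k hk => le_waitGain_bestItem (r + 1) x hk)
          (fun k hk => bestItem_le_waitGain (r + 1) x hk) hxy hz hb1 hk
      have hpj : p (some j) = 1 - p none := by
        have := sum_option_eq hp0 fun _ => 1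
        simp only [mul_one, hp1] at this
        linarith
      have hqj : q (some j) = 1 - q none := by
        have := sum_option_eq hq0 fun _ => 1
        simp only [mul_one, hq1] at this
        linarith
      rw [← hv0] at hb0
      rw [← hv1] at hb1
      have hb0n := hb0 none (Or.inl rfl)
      have hb0j := hb0 (some j) (Or.inr rfl)
      have hb1n := hb1 none (Or.inl rfl)
      have hb1j := hb1 (some j) (Or.inr rfl)
      rw [sum_option_eq hp0] at hv0 hb1n hb1j
      rw [sum_option_eq hq0] at hv1 hb0n hb0j
      rw [sum_option_eq hq0, sum_option_eq hq0] at hv0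
      rw [sum_option_eq hp0, sum_option_eq hp0] at hv1
      simp only [stageGain, if_true, hpj, hqj, hxj, hyj] at hv0 hv1 hb0n hb0j hb1n hb1j
      obtain ⟨h1, h2, h3⟩ := two_action_equilibrium (hp none) (by linarith [hp (some j)]) (hq none)
        (by linarith [hq (some j)]) hgt hv0 hv1 hb0n hb0j hb1n hb1j
      refine ⟨h1, ?_, ?_⟩
      · rwa [low_succ, L, if_neg (not_le.2 hgt)]
      -- Either the payoff is the stopping payoff, which is at most `high` anyway, or `x ≤ z ≤
      -- nextHigh`, so that `H` is in its continuation branch.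
      · rcases h3 with h3 | ⟨h3, h4⟩
        · rw [h3]
          exact (half_le_low F (r + 1) hba).trans (low_le_high F (r + 1) hba)
        · rw [high_succ, H, if_neg (not_lt.2 ((h3.trans hzhigh).trans (le_max_right _ _)))]
          exact h4.trans hzhigh

end Necessity

/-! ### Cutoff equilibria. -/

section Existence

variable (F : Measure unitInterval) (n : ℕ) (c : unitInterval)

/-- The payoff `high` if the first sample is at most `c`, the payoff `low` otherwise. -/
noncomputable def target (r : ℕ) {t : ℕ} (x : Fin (t + 1) → unitInterval) : ℝ :=
  if x 0 ≤ c then high F r (best Finset.univ x) (secondBest Finset.univ x)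
  else low F r (best Finset.univ x) (secondBest Finset.univ x)

/-- The expected value of `target` at the next stage. -/
noncomputable def nextTarget (r : ℕ) {t : ℕ} (x : Fin (t + 1) → unitInterval) : ℝ :=
  if x 0 ≤ c then nextHigh F r (best Finset.univ x) (secondBest Finset.univ x)
  else nextLow F r (best Finset.univ x) (secondBest Finset.univ x)

/-- The samples at which to bid in the equilibrium with payoff `target`. -/
def bidSet (t : ℕ) : Set (Fin (t + 1) → unitInterval) :=
  {x | expMax F (n - t - 1) (secondBest Finset.univ x) < (best Finset.univ x : ℝ) ∧
    (x 0 ≤ c → nextHigh F (n - t - 2) (best Finset.univ x) (secondBest Finset.univ x) <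
      (best Finset.univ x : ℝ))}

/-- The choice between `high` and `low` depends on the first sample only, so it is settled before
the new sample is drawn and commutes with the integral. -/
lemma integral_target_snoc (r : ℕ) {t : ℕ} (x : Fin (t + 1) → unitInterval) :
    ∫ y, target F c r (Fin.snoc x y : Fin (t + 2) → unitInterval) ∂F = nextTarget F c r x := by
  have h0 : ∀ y, (Fin.snoc x y : Fin (t + 2) → unitInterval) 0 = x 0 := fun y => by
    rw [← Fin.castSucc_zero, Fin.snoc_castSucc]
  simp only [target, nextTarget, h0, best_univ_snoc, secondBest_univ_snoc]
  split_ifs <;> rfl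

lemma target_succ_of_mem {F : Measure unitInterval} {n : ℕ} {c : unitInterval} {t r : ℕ} (h : t + 1 + (r + 1) = n) {x : Fin (t + 1) → unitInterval}
    (hx : x ∈ bidSet F n c t) :
    waitGain F (r + 1) x (bestItem x) < x (bestItem x) ∧
      target F c (r + 1) x = (x (bestItem x) + waitGain F (r + 1) x (bestItem x)) / 2 := by
  obtain ⟨h1, h2⟩ := hx
  -- With `r + 1` stages to come, the truncated subtractions in `bidSet` are `r + 1` and `r`. They
  -- could truncate only from the last stage on, where bids play no role.
  rw [show n - t - 1 = r + 1 by omega] at h1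
  rw [show n - t - 2 = r by omega] at h2
  rw [waitGain_bestItem, apply_bestItem x]
  refine ⟨h1, ?_⟩
  rw [target, low_succ, high_succ, L, H, if_neg (not_le.2 h1)]
  split_ifs with h3 h4
  · rfl
  · exact absurd (max_lt h1 (h2 h3)) h4
  · rfl

variable [IsProbabilityMeasure F]

lemma measurable_target (r t : ℕ) : Measurable fun x : Fin (t + 1) → unitInterval => target F c r x := by
  have h : Measurable fun x : Fin (t + 1) → unitInterval =>
      (best Finset.univ x, secondBest Finset.univ x) :=
    (continuous_best _).measurable.prodMk (continuous_secondBest _).measurable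
  exact Measurable.ite (measurableSet_le (measurable_pi_apply 0) measurable_const)
    ((measurable_high F r).comp h) ((measurable_low F r).comp h)

lemma abs_target_le (r : ℕ) {t : ℕ} (x : Fin (t + 1) → unitInterval) : |target F c r x| ≤ 1 := by
  unfold target
  split_ifs
  · exact abs_high_le F _ _ _
  · exact abs_low_le F _ _ _

lemma integrable_target_snoc (r : ℕ) {t : ℕ} (x : Fin t → unitInterval) :
    Integrable (fun y => target F c r (Fin.snoc x y : Fin (t + 1) → unitInterval)) F :=
  integrable_of_abs_le ((measurable_target F c r t).comp
    (measurable_snoc.comp measurable_prodMk_left)) fun _ => abs_target_le F c r _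

lemma measurableSet_bidSet (t : ℕ) : MeasurableSet (bidSet F n c t) := by
  have h : Measurable fun x : Fin (t + 1) → unitInterval =>
      (best Finset.univ x, secondBest Finset.univ x) :=
    (continuous_best _).measurable.prodMk (continuous_secondBest _).measurable
  have hbest : Measurable fun x : Fin (t + 1) → unitInterval => (best Finset.univ x : ℝ) :=
    measurable_subtype_coe.comp (continuous_best _).measurable
  have h1 : MeasurableSet {x : Fin (t + 1) → unitInterval |
      expMax F (n - t - 1) (secondBest Finset.univ x) < (best Finset.univ x : ℝ)} :=
    measurableSet_lt ((measurable_expMax F _).comp (continuous_secondBest _).measurable) hbest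
  have h2 : MeasurableSet {x : Fin (t + 1) → unitInterval | x 0 ≤ c} :=
    measurableSet_le (measurable_pi_apply 0) measurable_const
  have h3 : MeasurableSet {x : Fin (t + 1) → unitInterval |
      nextHigh F (n - t - 2) (best Finset.univ x) (secondBest Finset.univ x) <
      (best Finset.univ x : ℝ)} := measurableSet_lt ((measurable_nextHigh F _).comp h) hbest
  have : bidSet F n c t = {x : Fin (t + 1) → unitInterval |
      expMax F (n - t - 1) (secondBest Finset.univ x) < (best Finset.univ x : ℝ)} ∩
      ({x : Fin (t + 1) → unitInterval | x 0 ≤ c}ᶜ ∪ {x : Fin (t + 1) → unitInterval |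
      nextHigh F (n - t - 2) (best Finset.univ x) (secondBest Finset.univ x) <
      (best Finset.univ x : ℝ)}) := by
    ext x
    simp only [bidSet, Set.mem_ofPred_eq, Set.mem_inter_iff, Set.mem_union, Set.mem_compl_iff,
      imp_iff_not_or]
  rw [this]
  exact h1.inter (h2.compl.union h3)

/-- The equilibrium with payoff `target`. -/
noncomputable def cutoffProfile : Profile :=
  fun i => bidStrategy (bidSet F n c) (measurableSet_bidSet F n c) i

variable {F n c}

lemma cutoffProfile_prob_some (i : Player) {t : ℕ} {x : Fin (t + 1) → unitInterval}
    (hx : x ∈ bidSet F n c t) :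
    (cutoffProfile F n c i).prob (passHist t) x (some (bestItem x)) = 1 :=
  bidStrategy_prob_some _ i hx

lemma cutoffProfile_prob_none (i : Player) {t : ℕ} {x : Fin (t + 1) → unitInterval}
    (hx : x ∉ bidSet F n c t) : (cutoffProfile F n c i).prob (passHist t) x none = 1 :=
  bidStrategy_prob_none _ i hx

/-- Passing must be a best reply to passing. If `a` is at most the waiting value, then `a` is at
most their average, which is at most `nextLow`; otherwise the failed condition in `bidSet` says
directly that `a` is at most `nextHigh`. -/
lemma target_succ_of_notMem {t r : ℕ} (h : t + 1 + (r + 1) = n) {x : Fin (t + 1) → unitInterval}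
    (hx : x ∉ bidSet F n c t) :
    (x (bestItem x) : ℝ) ≤ nextTarget F c r x ∧ target F c (r + 1) x = nextTarget F c r x := by
  have hba := secondBest_le_best Finset.univ x
  have hz := half_le_nextLow F r hba
  have hz' := nextLow_le_nextHigh F r (best Finset.univ x) (secondBest Finset.univ x)
  simp only [bidSet, Set.mem_ofPred_eq, not_and_or, not_lt, Classical.not_imp] at hx
  rw [show n - t - 1 = r + 1 by omega, show n - t - 2 = r by omega] at hx
  rw [apply_bestItem x, target, nextTarget, low_succ, high_succ, L, H]
  rcases hx with hx | ⟨hx, hx'⟩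
  · rw [if_pos hx, if_neg (not_lt.2 (hx.trans (le_max_left _ _)))]
    refine ⟨?_, rfl⟩
    split_ifs <;> linarith
  · rw [if_pos hx, if_pos hx, if_neg (not_lt.2 (hx'.trans (le_max_right _ _)))]
    exact ⟨hx', rfl⟩

lemma cutoffProfile_waitsAlone (r t : ℕ) (i : Player) :
    WaitsAlone F (cutoffProfile F n c) r t i :=
  fun _ _ hp x => value_solo_eq _ r x (passesAlone_bidStrategy _ i) hp

lemma value_cutoffProfile (r t : ℕ) (h : t + 1 + r = n) (x : Fin (t + 1) → unitInterval)
    (i : Player) : value F (cutoffProfile F n c) r (passHist t) x i = target F c r x := by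
  induction r generalizing t with
  | zero => rw [value_zero_passHist, target]; split_ifs <;> rfl
  | succ r ih =>
    have hz : passGain F (cutoffProfile F n c) r x i = nextTarget F c r x := by
      rw [← integral_target_snoc]
      simp only [passGain]
      congr 1
      funext y
      exact ih (t + 1) (by omega) _
    rw [value_passHist_eq (cutoffProfile_waitsAlone r (t + 1) i), hz]
    simp only [mul_assoc, ← Finset.mul_sum]
    by_cases hx : x ∈ bidSet F n c t
    · rw [sum_mul_of_eq_one _ (cutoffProfile_prob_some i hx),
        sum_mul_of_eq_one _ (cutoffProfile_prob_some (opp i) hx), (target_succ_of_mem h hx).2]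
      simp [stageGain]
    · rw [sum_mul_of_eq_one _ (cutoffProfile_prob_none i hx),
        sum_mul_of_eq_one _ (cutoffProfile_prob_none (opp i) hx), (target_succ_of_notMem h hx).2]
      rfl

/-- Arbitrary deviations are handled by backward induction: the stage gain is monotone in the
continuation, so each stage reduces to best replies against a pure action. Against a bid for the
best item, sharing it is optimal; against passing, so is passing. -/
lemma value_update_cutoffProfile_le (i : Player) (τ : Strategy i) (r t : ℕ) (h : t + 1 + r = n)
    (x : Fin (t + 1) → unitInterval) :
    value F (Function.update (cutoffProfile F n c) i τ) r (passHist t) x i ≤ target F c r x := by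
  induction r generalizing t with
  | zero => rw [value_zero_passHist, target]; split_ifs <;> exact le_rfl
  | succ r ih =>
    have hz : passGain F (Function.update (cutoffProfile F n c) i τ) r x i ≤
        nextTarget F c r x := by
      rw [← integral_target_snoc]
      exact integral_mono (integrable_value_snoc _ r _ x i) (integrable_target_snoc F c r x)
        fun y => ih (t + 1) (by omega) _
    refine (value_passHist_le _ r x i hz).trans ?_
    rw [Function.update_self, Function.update_of_ne (opp_ne i)]
    simp only [mul_assoc, ← Finset.mul_sum]
    have key : ∀ a, ∑ d, (cutoffProfile F n c (opp i)).prob (passHist t) x d *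
        stageGain (nextTarget F c r x) (fun k => x k) (waitGain F (r + 1) x) a d ≤
          target F c (r + 1) x := by
      intro a
      by_cases hx : x ∈ bidSet F n c t
      · obtain ⟨h1, h2⟩ := target_succ_of_mem h hx
        rw [sum_mul_of_eq_one _ (cutoffProfile_prob_some (opp i) hx), h2]
        rcases a with _ | k
        · simp only [stageGain]; linarith
        · by_cases hk : k = bestItem x
          · simp [stageGain, hk]
          · have := le_waitGain_bestItem (F := F) (r + 1) x hk
            simp only [stageGain, hk, if_false]
            linarith
      · obtain ⟨h1, h2⟩ := target_succ_of_notMem h hx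
        rw [sum_mul_of_eq_one _ (cutoffProfile_prob_none (opp i) hx), h2]
        rcases a with _ | k
        · exact le_rfl
        · exact le_trans (le_bestItem x k) h1
    calc _ ≤ ∑ a, τ.prob (passHist t) x a * target F c (r + 1) x :=
          Finset.sum_le_sum fun a _ => mul_le_mul_of_nonneg_left (key a) (τ.prob_nonneg _ x a)
      _ = _ := by rw [← Finset.sum_mul, τ.prob_sum, one_mul]

/-- After a possible record the deviator has left, is alone, or faces the opponent after constant
passing. The inequality after each draw integrates to the one before the draw. -/
lemma isSPE_cutoffProfile : IsSPE F n (cutoffProfile F n c) := by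
  intro t r h h' hh i τ
  have key : ∀ x : Fin (t + 1) → unitInterval,
      value F (Function.update (cutoffProfile F n c) i τ) r h' x i ≤
        value F (cutoffProfile F n c) r h' x i := by
    intro x
    by_cases hi : i ∈ present h'
    · by_cases ho : opp i ∈ present h'
      · have hp : present h' = Finset.univ := Finset.eq_univ_of_forall fun j => by
          by_cases hj : j = i
          · rwa [hj]
          · rwa [eq_opp_of_ne hj]
        rw [eq_passHist hh hp, value_cutoffProfile r t h]
        exact value_update_cutoffProfile_le i τ r t h x
      · have hp : present h' = {i} := by
          ext j
          rw [Finset.mem_singleton]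
          refine ⟨fun hj => ?_, fun hj => hj ▸ hi⟩
          by_contra hne
          exact ho (eq_opp_of_ne hne ▸ hj)
        rw [cutoffProfile_waitsAlone r t i h' hh hp]
        exact value_solo_le _ r x hp
    · rw [value_eq_zero_of_notMem _ r x hi, value_eq_zero_of_notMem _ r x hi]
  exact ⟨fun x => integral_mono (integrable_value_snoc _ r h' x i)
    (integrable_value_snoc _ r h' x i) fun y => key _, key⟩

end Existence

/-! ### The payoff set of the whole game. -/

section Payoffs

variable {F : Measure unitInterval}

lemma best_snoc_elim0 (y : unitInterval) :
    best Finset.univ (Fin.snoc Fin.elim0 y : Fin 1 → unitInterval) = y := by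
  simp [best, Fin.snoc]

lemma secondBest_fin_one (x : Fin 1 → unitInterval) : secondBest Finset.univ x = 0 := by
  simp [secondBest]
  rfl

lemma zero_sup_unitInterval (X : unitInterval) : 0 ⊔ X = X := bot_sup_eq X

lemma med_zero_zero (X : unitInterval) : med 0 0 X = 0 := by
  rw [med_of_ge le_rfl X.2.1]

variable [IsProbabilityMeasure F]

/-- At the state (0, 0) there is nothing worth bidding for and `L` continues, so the outermost step
of the recursion only draws the first sample. -/
lemma low_zero_zero (r : ℕ) : low F (r + 1) 0 0 = ∫ X, low F r X 0 ∂F := by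
  rw [low_succ, L, if_pos (by simpa using expMax_nonneg F (r + 1) 0), nextLow]
  simp only [zero_sup_unitInterval, med_zero_zero]

lemma high_zero_zero (r : ℕ) : high F (r + 1) 0 0 = ∫ X, high F r X 0 ∂F := by
  rw [high_succ, H, if_neg, nextHigh]
  · simp only [zero_sup_unitInterval, med_zero_zero]
  · exact not_lt.2 (le_max_of_le_left (by simpa using expMax_nonneg F (r + 1) 0))

lemma integrable_low_zero (r : ℕ) : Integrable (fun X => low F r X 0) F := by
  simpa only [zero_sup_unitInterval, med_zero_zero] using integrable_low_next F r 0 0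

lemma integrable_high_zero (r : ℕ) : Integrable (fun X => high F r X 0) F := by
  simpa only [zero_sup_unitInterval, med_zero_zero] using integrable_high_next F r 0 0

lemma low_le_high_zero (n : ℕ) : low F n 0 0 ≤ high F n 0 0 := low_le_high F n le_rfl

lemma IsSPE.payoff_mem (hF : ∀ x, F {x} = 0) {n : ℕ} (hn : 1 ≤ n) {σ : Profile}
    (hσ : IsSPE F n σ) : payoff F σ n 0 = payoff F σ n 1 ∧
      payoff F σ n 0 ∈ Set.Icc (low F n 0 0) (high F n 0 0) := by
  obtain ⟨r, rfl⟩ := Nat.exists_eq_add_of_le' hn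
  have key : ∀ᵐ X ∂F,
      value F σ r (passHist 0) (Fin.snoc Fin.elim0 X : Fin 1 → unitInterval) 0 =
          value F σ r (passHist 0) (Fin.snoc Fin.elim0 X : Fin 1 → unitInterval) 1 ∧
        low F r X 0 ≤ value F σ r (passHist 0) (Fin.snoc Fin.elim0 X : Fin 1 → unitInterval) 0 ∧
        value F σ r (passHist 0) (Fin.snoc Fin.elim0 X : Fin 1 → unitInterval) 0 ≤
          high F r X 0 := by
    filter_upwards [ae_regular_start hF r] with X hX
    have := hσ.value_passHist hF r 0 (by omega) (Fin.snoc Fin.elim0 X : Fin 1 → unitInterval)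
    rw [best_snoc_elim0, secondBest_fin_one] at this
    exact this hX
  have hint := integrable_value_snoc (F := F) σ r (passHist 0) Fin.elim0 0
  rw [low_zero_zero, high_zero_zero]
  exact ⟨integral_congr_ae (key.mono fun X hX => hX.1),
    integral_mono_ae (integrable_low_zero r) hint (key.mono fun X hX => hX.2.1),
    integral_mono_ae hint (integrable_high_zero r) (key.mono fun X hX => hX.2.2)⟩

/-- The payoff of the equilibrium which switches from `high` to `low` at the cutoff `c`. -/
noncomputable def cutoffPayoff (F : Measure unitInterval) (r : ℕ) (c : unitInterval) : ℝ :=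
  ∫ X, (if X ≤ c then high F r X 0 else low F r X 0) ∂F

lemma payoff_cutoffProfile (r : ℕ) (c : unitInterval) (i : Player) :
    payoff F (cutoffProfile F (r + 1) c) (r + 1) i = cutoffPayoff F r c := by
  simp only [payoff, valueBefore, cutoffPayoff]
  congr 1
  funext X
  refine (value_cutoffProfile (F := F) (c := c) r 0 (by omega) _ i).trans ?_
  rw [target, best_snoc_elim0, secondBest_fin_one]
  rfl

/-- For `X ≠ c` the integrand is locally constant in the cutoff near `c`, and the exceptional point
is null; dominated convergence applies. -/
lemma continuous_cutoffPayoff (hF : ∀ x, F {x} = 0) (r : ℕ) : Continuous (cutoffPayoff F r) := by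
  refine continuous_iff_continuousAt.2 fun c => ?_
  refine continuousAt_of_dominated (bound := fun _ => 1) (Filter.Eventually.of_forall fun d => ?_)
    (Filter.Eventually.of_forall fun d => Filter.Eventually.of_forall fun X => ?_)
    (integrable_const _) ?_
  · have hmeas : Measurable fun X : unitInterval => (X, (0 : unitInterval)) := measurable_id.prodMk measurable_const
    exact (Measurable.ite measurableSet_Iic ((measurable_high F r).comp hmeas)
      ((measurable_low F r).comp hmeas)).aestronglyMeasurable
  · rw [Real.norm_eq_abs]
    split_ifs
    · exact abs_high_le F _ _ _
    · exact abs_low_le F _ _ _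
  · have : ∀ᵐ X ∂F, X ≠ c := by simpa [ae_iff] using hF c
    filter_upwards [this] with X hX
    rcases lt_or_gt_of_ne hX with h | h
    · refine (continuousAt_const (y := high F r X 0)).congr ?_
      filter_upwards [lt_mem_nhds h] with d hd
      rw [if_pos (le_of_lt hd)]
    · refine (continuousAt_const (y := low F r X 0)).congr ?_
      filter_upwards [gt_mem_nhds h] with d hd
      rw [if_neg (not_le.2 hd)]

lemma cutoffPayoff_one (r : ℕ) : cutoffPayoff F r 1 = high F (r + 1) 0 0 := by
  rw [high_zero_zero, cutoffPayoff]
  congr 1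
  funext X
  exact if_pos X.2.2

lemma cutoffPayoff_zero (hF : ∀ x, F {x} = 0) (r : ℕ) :
    cutoffPayoff F r 0 = low F (r + 1) 0 0 := by
  rw [low_zero_zero, cutoffPayoff]
  refine integral_congr_ae ?_
  have : ∀ᵐ X ∂F, X ≠ (0 : unitInterval) := by simpa [ae_iff] using hF 0
  filter_upwards [this] with X hX
  rw [if_neg fun h => hX (le_antisymm h X.2.1)]

lemma spePayoffs_eq_image (hF : ∀ x, F {x} = 0) {n : ℕ} (hn : 1 ≤ n) :
    spePayoffs F n = (fun v : ℝ => (v, v)) '' Set.Icc (low F n 0 0) (high F n 0 0) := by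
  ext p
  constructor
  · rintro ⟨σ, hσ, rfl⟩
    obtain ⟨h1, h2⟩ := hσ.payoff_mem hF hn
    exact ⟨_, h2, by rw [← h1]⟩
  · rintro ⟨v, hv, rfl⟩
    obtain ⟨r, rfl⟩ := Nat.exists_eq_add_of_le' hn
    -- Cutoff 0 gives the lower endpoint and cutoff 1 the upper one, so some cutoff gives `v`.
    have h := intermediate_value_univ 0 1 (continuous_cutoffPayoff hF r)
    rw [cutoffPayoff_zero hF, cutoffPayoff_one] at h
    obtain ⟨c, rfl⟩ := h hv
    exact ⟨cutoffProfile F (r + 1) c, isSPE_cutoffProfile, by simp only [payoff_cutoffProfile]⟩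

lemma image_diag_eq_segment {l h : ℝ} (hlh : l ≤ h) :
    (fun v : ℝ => (v, v)) '' Set.Icc l h = segment ℝ (l, l) (h, h) := by
  rw [← segment_eq_Icc hlh]
  exact image_segment ℝ (LinearMap.prod LinearMap.id LinearMap.id).toAffineMap l h

lemma extremePoints_image_diag {l h : ℝ} (hlh : l ≤ h) :
    Set.extremePoints ℝ ((fun v : ℝ => (v, v)) '' Set.Icc l h) = {(l, l), (h, h)} := by
  ext p
  constructor
  · rintro ⟨⟨v, ⟨h1, h2⟩, rfl⟩, hext⟩
    by_contra hne
    simp only [Set.mem_insert_iff, Set.mem_singleton_iff, Prod.mk.injEq, and_self, not_or] at hne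
    have h1' := lt_of_le_of_ne h1 (Ne.symm hne.1)
    have h2' := lt_of_le_of_ne h2 hne.2
    -- A value strictly between `l` and `h` is their combination with weights `(h - v) / (h - l)`
    -- and `(v - l) / (h - l)`, both positive, so it is not extreme.
    have := hext ⟨l, ⟨le_rfl, hlh⟩, rfl⟩ ⟨h, ⟨hlh, le_rfl⟩, rfl⟩
      ⟨(h - v) / (h - l), (v - l) / (h - l), div_pos (by linarith) (by linarith),
        div_pos (by linarith) (by linarith), ?_, ?_⟩
    · exact hne.1 (congrArg Prod.fst this).symm
    · rw [← add_div]; exact (div_eq_one_iff_eq (by linarith)).2 (by ring)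
    · have h3 : h - l ≠ 0 := by linarith
      ext <;> simp <;> field_simp <;> ring
  · rintro (rfl | rfl)
    · refine ⟨⟨l, ⟨le_rfl, hlh⟩, rfl⟩, ?_⟩
      rintro _ ⟨u, ⟨hu, -⟩, rfl⟩ _ ⟨v, ⟨hv, -⟩, rfl⟩ ⟨s, s', hs, hs', hss, he⟩
      have he' : s * u + s' * v = l := by simpa using congrArg Prod.fst he
      have : u = l := by
        refine le_antisymm ?_ hu
        by_contra! h4
        obtain rfl : s' = 1 - s := by linarith
        linarith [mul_pos hs (sub_pos.2 h4), mul_nonneg hs'.le (sub_nonneg.2 hv)]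
      rw [this]
    · refine ⟨⟨h, ⟨hlh, le_rfl⟩, rfl⟩, ?_⟩
      rintro _ ⟨u, ⟨-, hu⟩, rfl⟩ _ ⟨v, ⟨-, hv⟩, rfl⟩ ⟨s, s', hs, hs', hss, he⟩
      have he' : s * u + s' * v = h := by simpa using congrArg Prod.fst he
      have : u = h := by
        refine le_antisymm hu ?_
        by_contra! h4
        obtain rfl : s' = 1 - s := by linarith
        linarith [mul_pos hs (sub_pos.2 h4), mul_nonneg hs'.le (sub_nonneg.2 hv)]
      rw [this]

end Payoffs

end FullRecall

theorem mainTheorem2 (F : MeasureTheory.Measure unitInterval)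
    [MeasureTheory.IsProbabilityMeasure F] (hF : ∀ x, F {x} = 0) (n : ℕ) (hn : 1 ≤ n) :
    FullRecall.spePayoffs F n =
        {p | ∃ c ∈ Set.Icc (0 : ℝ) 1,
          p = c • (FullRecall.low F n 0 0, FullRecall.low F n 0 0) +
            (1 - c) • (FullRecall.high F n 0 0, FullRecall.high F n 0 0)} ∧
      Convex ℝ (FullRecall.spePayoffs F n) ∧
      FullRecall.spePayoffs F n ⊆ {p | p.1 = p.2} ∧
      Set.extremePoints ℝ (FullRecall.spePayoffs F n) =
        {(FullRecall.low F n 0 0, FullRecall.low F n 0 0),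
          (FullRecall.high F n 0 0, FullRecall.high F n 0 0)} := by
  have hlh := FullRecall.low_le_high_zero (F := F) n
  rw [FullRecall.spePayoffs_eq_image hF hn]
  refine ⟨?_, ?_, ?_, FullRecall.extremePoints_image_diag hlh⟩
  · rw [FullRecall.image_diag_eq_segment hlh]
    ext p
    constructor
    · rintro ⟨s, s', hs, hs', hss, rfl⟩
      exact ⟨s, ⟨hs, by linarith⟩, by rw [← hss, add_sub_cancel_left]⟩
    · rintro ⟨s, ⟨hs, hs'⟩, rfl⟩
      exact ⟨s, 1 - s, hs, by linarith, by ring, rfl⟩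
  · rw [FullRecall.image_diag_eq_segment hlh]
    exact convex_segment _ _
  · rintro _ ⟨v, -, rfl⟩
    rfl
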